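/- **Setting.** Let $U\subset\mathbb R^2$ be a bounded open set containing the origin $O=(0,0)$, let $f,\phi:\mathbb R^2\to\mathbb R$ be $C^\infty$ with $f(O)\ne0$, $\phi(O)\neq 0$, and let $m\ge 1$ be an integer (the data $f^+,\phi^+,m^+$ of the upper subsystem of a piecewise-smooth system with switching line $y=0$). Consider, on $\{(x,y)\in U: y\ge 0\}$, the upper subsystem $$\dot x=f(x,y),\qquad \dot y=\phi(x,y)\,x^{m} \tag{1}$$ and its unfolding, with parameters $\lambda=(\lambda_1,\dots,\lambda_m)\in\mathbb R^m$ and a function $\psi=\psi(x,k)$, $$\dot x=f(x,y+\psi),\qquad \dot y=\phi(x,y+\psi)\prod_{i=1}^{m}(x-\lambda_i)-f(x,y+\psi)\,\frac{d\psi}{dx}. \tag{2}$$ *Tangent points.* A point $(x_0,0)$ is a tangent point of a planar vector field $Z=(Z_1,Z_2)$ if $Z_2(x_0,0)=0\neq Z_1(x_0,0)$. It splits the local orbit through it into a left and a right segment; the tangent point is visible (resp. invisible, left, right) if both (resp. neither, only the left one, only the right one) of these segments lie in $y>0$. *The functional function.* For $r_1<r_2$ put $\eta(x)=\frac1{x-r_1}+\frac1{x-r_2}$.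 Let $h^*(x,r_1,r_2)$ be $0$ for $x\le r_1$, $\frac1{1+e^{\eta(x)}}$ for $r_1<x<r_2$, and $1$ for $x\ge r_2$; and let $h_*(x,r_1,r_2)$ be $1$, $\frac{e^{\eta(x)}}{1+e^{\eta(x)}}$, $0$ on the same three sets. For an integer $d>0$ let $\mathcal K=\{k\in\mathbb R^{3d+1}: k_1<k_2<\dots<k_{2d+1}\}$. For $k\in\mathcal K$ let $$\psi(x,k)=\begin{cases}k_{2d+1+i}\,h^*(x,k_{2i-1},k_{2i}), & x\in(k_{2i-1},k_{2i}],\\ k_{2d+1+i}\,h_*(x,k_{2i},k_{2i+1}), & x\in(k_{2i},k_{2i+1}],\\ 0,&\text{otherwise}\end{cases}\qquad (i=1,\dots,d),$$ and for $k\notin\mathcal K$ let $\psi(x,k)=k_{2d+2}\,h^*(x,r_1,r_2)$, where $r_1<r_2$ are fixed constants. *Orbits.* Orbits of (2) are considered in $\{(x,y)\in U:y\ge0\}$: an orbit segment is a maximal piece of an orbit that stays in this set, i.e. a class of points joined to each other by solution arcs of (2) inside this set. **Theorem.** Suppose that $O$ is an invisible tangent point of (1) and $m>1$; put $N=(m-1)/2$.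 Or suppose that $O$ is a visible, left or right tangent point of (1) and $m\ge1$; put $N=\lfloor (m+1)/2\rfloor$. Then for each $\ell\in\{1,\dots,N\}$ and all fixed $r_1<r_2$ there are an integer $d>0$ and a number $r>0$ such that for every $\varepsilon>0$ there exist $\lambda\in\mathbb R^m$ and $k\in\mathbb R^{3d+1}$ with the following properties. 1. (Small perturbation.) $|\lambda_i|<\varepsilon$ and $|k_i|<\varepsilon$ for all $i$; if $k\in\mathcal K$, then $|k_{2d+1+i}|\le\varepsilon\,(k_{2i}-k_{2i-1})^4$ and $k_{2i+1}-k_{2i}=k_{2i}-k_{2i-1}$ for $i=1,\dots,d$; and for each component $X$ of the difference of the vector fields (2), with $\psi=\psi(x,k)$, and (1), $|X|+|\partial_xX|+|\partial_yX|<\varepsilon$ on $\overline U$. 2. (Bifurcation from $O$.) All tangent points $(x,0)$ of (2) with $|x|<r$ satisfy $|x|<\varepsilon$; these are called the tangent points bifurcating from $O$. 3. There are exactly $\lfloor N/\ell\rfloor$ orbit segments of (2) in $\{(x,y)\in U: y\ge 0\}$ that pass through exactly $\ell$ visible tangent points bifurcating from $O$. (That is, $\lfloor(m-1)/(2\ell)\rfloor$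 of them in the invisible case and $\lfloor(m+1)/(2\ell)\rfloor$ in the other cases.) -/

import Mathlib

open scoped ContDiff

noncomputable section

namespace TangentBifurcation

/-! ### Orbits, tangent points and their visibility, for a planar vector field `Z` considered in
the closed upper half-plane `y ≥ 0`, with switching line `y = 0`. -/

/-- `γ` is a solution of `γ' = Z(γ)` on the set `I` of times. -/
def IsSolutionOn (Z : ℝ × ℝ → ℝ × ℝ) (γ : ℝ → ℝ × ℝ) (I : Set ℝ) : Prop :=
  ∀ t ∈ I, HasDerivWithinAt γ (Z (γ t)) I t

/-- `(x₀, 0)` is a tangent point of `Z`. -/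
def IsTangentPoint (Z : ℝ × ℝ → ℝ × ℝ) (x₀ : ℝ) : Prop :=
  (Z (x₀, 0)).2 = 0 ∧ (Z (x₀, 0)).1 ≠ 0

/-- The part of the local orbit through `(x₀, 0)` to the left of `(x₀, 0)` lies in `y > 0`. -/
def LeftSegmentAbove (Z : ℝ × ℝ → ℝ × ℝ) (x₀ : ℝ) : Prop :=
  ∃ τ > 0, ∃ γ : ℝ → ℝ × ℝ, IsSolutionOn Z γ (Set.Ioo (-τ) τ) ∧ γ 0 = (x₀, 0) ∧
    ∀ t ∈ Set.Ioo (-τ) τ, (γ t).1 < x₀ → 0 < (γ t).2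

/-- The part of the local orbit through `(x₀, 0)` to the right of `(x₀, 0)` lies in `y > 0`. -/
def RightSegmentAbove (Z : ℝ × ℝ → ℝ × ℝ) (x₀ : ℝ) : Prop :=
  ∃ τ > 0, ∃ γ : ℝ → ℝ × ℝ, IsSolutionOn Z γ (Set.Ioo (-τ) τ) ∧ γ 0 = (x₀, 0) ∧
    ∀ t ∈ Set.Ioo (-τ) τ, x₀ < (γ t).1 → 0 < (γ t).2

/-- Visible tangent point: both segments lie above. -/
def IsVisible (Z : ℝ × ℝ → ℝ × ℝ) (x₀ : ℝ) : Prop :=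
  IsTangentPoint Z x₀ ∧ LeftSegmentAbove Z x₀ ∧ RightSegmentAbove Z x₀

/-- Invisible tangent point: neither segment lies above. -/
def IsInvisible (Z : ℝ × ℝ → ℝ × ℝ) (x₀ : ℝ) : Prop :=
  IsTangentPoint Z x₀ ∧ ¬ LeftSegmentAbove Z x₀ ∧ ¬ RightSegmentAbove Z x₀

/-- Left tangent point: only the left segment lies above. -/
def IsLeft (Z : ℝ × ℝ → ℝ × ℝ) (x₀ : ℝ) : Prop :=
  IsTangentPoint Z x₀ ∧ LeftSegmentAbove Z x₀ ∧ ¬ RightSegmentAbove Z x₀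

/-- Right tangent point: only the right segment lies above. -/
def IsRight (Z : ℝ × ℝ → ℝ × ℝ) (x₀ : ℝ) : Prop :=
  IsTangentPoint Z x₀ ∧ ¬ LeftSegmentAbove Z x₀ ∧ RightSegmentAbove Z x₀

/-- The closed upper part of `U` (the closure of `{y > 0} ∩ U` relative to the open set `U`). -/
def upperRegion (U : Set (ℝ × ℝ)) : Set (ℝ × ℝ) := {p | p ∈ U ∧ 0 ≤ p.2}

/-- `p` and `q` are joined by an orbit arc of `Z` (in one of the two time directions) that does not
leave `D`. -/
def JoinedIn (Z : ℝ × ℝ → ℝ × ℝ) (D : Set (ℝ × ℝ)) (p q : ℝ × ℝ) : Prop :=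
  ∃ (γ : ℝ → ℝ × ℝ) (a b : ℝ), a ≤ b ∧ IsSolutionOn Z γ (Set.Icc a b) ∧
    (∀ t ∈ Set.Icc a b, γ t ∈ D) ∧ ((γ a = p ∧ γ b = q) ∨ (γ a = q ∧ γ b = p))

/-- `Γ` is a (maximal) orbit segment of `Z` in `D`. -/
def IsOrbitSegment (Z : ℝ × ℝ → ℝ × ℝ) (D Γ : Set (ℝ × ℝ)) : Prop :=
  ∃ p ∈ D, Γ = {q | JoinedIn Z D p q}

/-- The visible tangent points of `Z` on `Γ` whose distance to the origin is less than `r`. -/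
def visiblePointsOn (Z : ℝ × ℝ → ℝ × ℝ) (r : ℝ) (Γ : Set (ℝ × ℝ)) : Set (ℝ × ℝ) :=
  {p | p ∈ Γ ∧ p.2 = 0 ∧ |p.1| < r ∧ IsVisible Z p.1}

/-! ### The functional function -/

/-- `1/(x - r₁) + 1/(x - r₂)`. -/
def eta (r₁ r₂ x : ℝ) : ℝ := 1 / (x - r₁) + 1 / (x - r₂)

/-- The increasing smooth cutoff function. -/
def cutoffUp (r₁ r₂ x : ℝ) : ℝ :=
  if x ≤ r₁ then 0 else if x < r₂ then 1 / (1 + Real.exp (eta r₁ r₂ x)) else 1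

/-- The decreasing smooth cutoff function. -/
def cutoffDown (r₁ r₂ x : ℝ) : ℝ :=
  if x ≤ r₁ then 1
  else if x < r₂ then Real.exp (eta r₁ r₂ x) / (1 + Real.exp (eta r₁ r₂ x)) else 0

/-- The node `k_{j+1}`, `j = 0, …, 2d`, of the parameter vector `(k_1, …, k_{3d+1})`. -/
def node {d : ℕ} (k : Fin (3 * d + 1) → ℝ) (j : ℕ) (hj : j ≤ 2 * d) : ℝ :=
  k ⟨j, by omega⟩

/-- The amplitude `k_{2d+2+j}`, `j = 0, …, d-1`, of the parameter vector `(k_1, …, k_{3d+1})`. -/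
def amp {d : ℕ} (k : Fin (3 * d + 1) → ℝ) (j : Fin d) : ℝ :=
  k ⟨2 * d + 1 + j, by have := j.isLt; omega⟩

/-- The set of parameter vectors with `k_1 < k_2 < ⋯ < k_{2d+1}`. -/
def orderedNodes (d : ℕ) : Set (Fin (3 * d + 1) → ℝ) :=
  {k | ∀ j : Fin (2 * d), node k j (by have := j.isLt; omega) <
    node k (j + 1) (by have := j.isLt; omega)}

/-- The bump of height `1` that increases on `(a, b]` and decreases on `(b, c]`. -/
def bump (a b c x : ℝ) : ℝ :=
  if a < x ∧ x ≤ b then cutoffUp a b x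
  else if b < x ∧ x ≤ c then cutoffDown b c x else 0

/-- `ψ^*`. The intervals of the `d` bumps are disjoint for ordered nodes, so the sum is the
piecewise definition. -/
def psiStar {d : ℕ} (k : Fin (3 * d + 1) → ℝ) (x : ℝ) : ℝ :=
  ∑ j : Fin d, amp k j *
    bump (node k (2 * j) (by have := j.isLt; omega))
      (node k (2 * j + 1) (by have := j.isLt; omega))
      (node k (2 * j + 2) (by have := j.isLt; omega)) x

open Classical in
/-- The functional function `x ↦ ψ(x, k)`, for `d > 0` and fixed constants `r₁ < r₂`. -/
def psi (r₁ r₂ : ℝ) {d : ℕ} (hd : 0 < d) (k : Fin (3 * d + 1) → ℝ) (x : ℝ) : ℝ :=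
  if k ∈ orderedNodes d then psiStar k x else amp k ⟨0, hd⟩ * cutoffUp r₁ r₂ x

/-- The smallness condition on the parameters of `ψ`, at level `ε`: every bump is symmetric, and its
height is at most `ε` times the fourth power of its half-width. -/
def SmallBumps (ε : ℝ) {d : ℕ} (k : Fin (3 * d + 1) → ℝ) : Prop :=
  ∀ j : Fin d,
    |amp k j| ≤ ε * (node k (2 * j + 1) (by have := j.isLt; omega) -
        node k (2 * j) (by have := j.isLt; omega)) ^ 4 ∧
    node k (2 * j + 2) (by have := j.isLt; omega) -
        node k (2 * j + 1) (by have := j.isLt; omega) =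
      node k (2 * j + 1) (by have := j.isLt; omega) -
        node k (2 * j) (by have := j.isLt; omega)

/-! ### The system and its unfolding -/

/-- The upper vector field `(f, φ x^m)`. -/
def upperField (f φ : ℝ × ℝ → ℝ) (m : ℕ) (p : ℝ × ℝ) : ℝ × ℝ :=
  (f p, φ p * p.1 ^ m)

/-- The upper vector field of the unfolding,
`(f(x, y+ψ), φ(x, y+ψ) ∏ (x - λ_i) - f(x, y+ψ) ψ')`. -/
def unfoldedField (f φ : ℝ × ℝ → ℝ) {m : ℕ} (lam : Fin m → ℝ) (ψ : ℝ → ℝ) (p : ℝ × ℝ) : ℝ × ℝ :=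
  (f (p.1, p.2 + ψ p.1),
    φ (p.1, p.2 + ψ p.1) * ∏ i, (p.1 - lam i) - f (p.1, p.2 + ψ p.1) * deriv ψ p.1)

/-- `|X - Y| + |∂ₓ(X - Y)| + |∂_y(X - Y)| < ε` on the closure of `U`. -/
def C1Close (ε : ℝ) (U : Set (ℝ × ℝ)) (X Y : ℝ × ℝ → ℝ) : Prop :=
  ∀ p ∈ closure U,
    |X p - Y p| + |deriv (fun x => X (x, p.2) - Y (x, p.2)) p.1| +
      |deriv (fun y => X (p.1, y) - Y (p.1, y)) p.2| < ε

/-- Under arbitrarily small perturbations within the unfolding, there are exactly `n` orbit segments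
in the closed upper part of `U` that pass through exactly `ℓ` visible tangent points bifurcating
from the origin. The tangent points bifurcating from the origin are those in a fixed neighbourhood
`|x| < r` of it; they tend to the origin with the size `ε` of the perturbation. -/
def HasBifurcatingTangentOrbits (f φ : ℝ × ℝ → ℝ) (m : ℕ) (U : Set (ℝ × ℝ)) (r₁ r₂ : ℝ)
    (ℓ n : ℕ) : Prop :=
  ∃ (d : ℕ) (hd : 0 < d), ∃ r > 0, ∀ ε > 0,
    ∃ (lam : Fin m → ℝ) (k : Fin (3 * d + 1) → ℝ),
      (∀ i, |lam i| < ε) ∧ (∀ i, |k i| < ε) ∧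
      (k ∈ orderedNodes d → SmallBumps ε k) ∧
      C1Close ε U (fun p => (unfoldedField f φ lam (psi r₁ r₂ hd k) p).1)
        (fun p => (upperField f φ m p).1) ∧
      C1Close ε U (fun p => (unfoldedField f φ lam (psi r₁ r₂ hd k) p).2)
        (fun p => (upperField f φ m p).2) ∧
      (∀ x, |x| < r → IsTangentPoint (unfoldedField f φ lam (psi r₁ r₂ hd k)) x → |x| < ε) ∧
      {Γ | IsOrbitSegment (unfoldedField f φ lam (psi r₁ r₂ hd k)) (upperRegion U) Γ ∧
        (visiblePointsOn (unfoldedField f φ lam (psi r₁ r₂ hd k)) r Γ).encard = (ℓ : ℕ∞)}.encard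
        = (n : ℕ∞)

end TangentBifurcation

end

/-!
# Tangent points on common orbits of an unfolded planar system

In the coordinates `(x, y + ψ x)` the unfolded system becomes the field `(f, φ ∏ (x - λ_i))`, which
does not depend on `ψ`; only its domain `y ≥ 0` turns into the region above the graph of `ψ`. So the
orbits are fixed first, for the equidistant roots `λ_i = s i`, and the graph of `ψ` is then raised
to touch them. Reversing time, one may assume `f (0, 0) > 0`.

* Every second root is a visible tangent point for `ψ = 0`. A bump of nonnegative height centred at
  such a root, with the neighbouring grid points as the ends of its support, has a slope of the
  opposite sign to `φ ∏ (x - λ_i)` (`GridConfig.prod_mul_deriv_nonpos`). Therefore no tangent points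
  arise beside the roots, and the visible ones are still the centres of the bumps
  (`GridConfig.isVisible_iff`).
* The `N` visible roots are divided into blocks of `ℓ` consecutive ones. For each block an orbit of the
  straightened field is chosen, and each bump of the block gets the height at which this orbit passes
  over its centre. Between two neighbouring roots of the block the orbit stays above the graph
  (`GridConfig.joinedIn_succ`), so the block lies on one orbit segment.
* The heights may be at most `ε s ^ 4`. The orbits vary by `O(s ^ 5)` from one visible root to another
  (`exists_group_orbit`), so initial heights between `K s ^ 5` and `2 K s ^ 5` make all bumps
  nonnegative and small enough. The same order suffices for the closeness of the fields, as the
  derivatives of the cutoffs up to order two are `O(s ^ (-4))` (`abs_deriv_deriv_cutoffUp_le`).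
* Orbits of different blocks must not be joined anywhere in `U`, even after a return from afar. An orbit
  crosses a vertical line transversally where `f ≠ 0`, hence at countably many of these heights only
  (`countable_joinedIn`),
  and as the straightened field does not depend on `ψ`, the initial heights of the blocks can be chosen
  on different orbits (`exists_seq_not_joined`).

The orbit segments with exactly `ℓ` visible tangent points are then those of the full blocks, and there
are `N / ℓ` of them (`encard_orbitSegments`).
-/

noncomputable section

namespace TangentBifurcation

open Set Filter Topology Metric

/-! ### Orbits of a continuously differentiable planar field -/

section ODE
variable {Z : ℝ × ℝ → ℝ × ℝ} {D : Set (ℝ × ℝ)} {p q r : ℝ × ℝ}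

theorem IsSolutionOn.mono {γ : ℝ → ℝ × ℝ} {I J : Set ℝ} (h : IsSolutionOn Z γ I) (hJ : J ⊆ I) :
    IsSolutionOn Z γ J := fun t ht => (h t (hJ ht)).mono hJ

theorem IsSolutionOn.continuousOn {γ : ℝ → ℝ × ℝ} {I : Set ℝ} (h : IsSolutionOn Z γ I) :
    ContinuousOn γ I := fun t ht => (h t ht).continuousWithinAt

theorem IsSolutionOn.comp_add_const {γ : ℝ → ℝ × ℝ} {I : Set ℝ} (h : IsSolutionOn Z γ I) (c : ℝ) :
    IsSolutionOn Z (fun t => γ (t + c)) ((fun t => t + c) ⁻¹' I) := by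
  intro t ht
  have := (h (t + c) ht).scomp t ((hasDerivAt_id t).add_const c).hasDerivWithinAt
    (s := (fun t => t + c) ⁻¹' I) (fun x hx => hx)
  simpa [Function.comp_def] using this

theorem IsSolutionOn.comp_const_sub {γ : ℝ → ℝ × ℝ} {I : Set ℝ} (h : IsSolutionOn Z γ I) (c : ℝ) :
    IsSolutionOn (-Z) (fun t => γ (c - t)) ((fun t => c - t) ⁻¹' I) := by
  intro t ht
  have := (h (c - t) ht).scomp t ((hasDerivAt_id t).const_sub c).hasDerivWithinAt
    (s := (fun t => c - t) ⁻¹' I) (fun x hx => hx)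
  simpa [Function.comp_def] using this

/-- `q` is reached from `p` by a solution arc of `Z` in `D`, forward in time. -/
def Reach (Z : ℝ × ℝ → ℝ × ℝ) (D : Set (ℝ × ℝ)) (p q : ℝ × ℝ) : Prop :=
  ∃ (γ : ℝ → ℝ × ℝ) (T : ℝ), 0 ≤ T ∧ IsSolutionOn Z γ (Icc 0 T) ∧
    (∀ t ∈ Icc 0 T, γ t ∈ D) ∧ γ 0 = p ∧ γ T = q

theorem Reach.of_Icc {γ : ℝ → ℝ × ℝ} {a b : ℝ} (hab : a ≤ b) (h : IsSolutionOn Z γ (Icc a b))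
    (hD : ∀ t ∈ Icc a b, γ t ∈ D) : Reach Z D (γ a) (γ b) := by
  refine ⟨fun t => γ (t + a), b - a, by linarith, (h.comp_add_const a).mono ?_, ?_, by simp, by simp⟩
  · intro t ht; simp only [mem_preimage, mem_Icc] at *; constructor <;> linarith
  · intro t ht; apply hD; simp only [mem_Icc] at *; constructor <;> linarith

theorem joinedIn_iff : JoinedIn Z D p q ↔ Reach Z D p q ∨ Reach Z D q p := by
  constructor
  · rintro ⟨γ, a, b, hab, h, hD, ⟨rfl, rfl⟩ | ⟨rfl, rfl⟩⟩
    · exact Or.inl (Reach.of_Icc hab h hD)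
    · exact Or.inr (Reach.of_Icc hab h hD)
  · rintro (⟨γ, T, hT, h, hD, h0, h1⟩ | ⟨γ, T, hT, h, hD, h0, h1⟩)
    · exact ⟨γ, 0, T, hT, h, hD, Or.inl ⟨h0, h1⟩⟩
    · exact ⟨γ, 0, T, hT, h, hD, Or.inr ⟨h0, h1⟩⟩

theorem Reach.neg (h : Reach Z D p q) : Reach (-Z) D q p := by
  obtain ⟨γ, T, hT, h, hD, h0, h1⟩ := h
  refine ⟨fun t => γ (T - t), T, hT, (h.comp_const_sub T).mono ?_, ?_, by simpa, by simpa⟩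
  · intro t ht; simp only [mem_preimage, mem_Icc] at *; constructor <;> linarith
  · intro t ht; apply hD; simp only [mem_Icc] at *; constructor <;> linarith

theorem Reach.refl (hp : p ∈ D) : Reach Z D p p := by
  refine ⟨fun _ => p, 0, le_rfl, ?_, fun _ _ => hp, rfl, rfl⟩
  intro t ht
  have : t = 0 := by simpa using ht
  subst this
  simp [hasDerivWithinAt_iff_hasFDerivWithinAt, HasFDerivWithinAt.of_subsingleton]

theorem Reach.trans (h₁ : Reach Z D p q) (h₂ : Reach Z D q r) : Reach Z D p r := by
  obtain ⟨γ, T, hT, h, hD, h0, h1⟩ := h₁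
  obtain ⟨γ', T', hT', h', hD', h0', h1'⟩ := h₂
  set g : ℝ → ℝ × ℝ := fun t => if t ≤ T then γ t else γ' (t - T) with hg
  have hgl : EqOn g γ (Icc 0 T) := fun t ht => if_pos ht.2
  have hgr : EqOn g (fun t => γ' (t + -T)) (Icc T (T + T')) := by
    intro t ht
    rcases ht.1.eq_or_lt with rfl | hlt
    · simp [hg, h1, h0']
    · simp [hg, hlt, sub_eq_add_neg]
  refine ⟨g, T + T', by linarith, ?_, ?_, ?_, ?_⟩
  · have hr' : IsSolutionOn Z (fun t => γ' (t + -T)) (Icc T (T + T')) := by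
      refine (h'.comp_add_const (-T)).mono ?_
      intro t ht; simp only [mem_preimage, mem_Icc] at *; constructor <;> linarith
    have hA : IsSolutionOn Z g (Icc 0 T) := by
      intro t ht
      rw [hgl ht]
      exact (h t ht).congr_of_mem hgl ht
    have hB : IsSolutionOn Z g (Icc T (T + T')) := by
      intro t ht
      rw [hgr ht]
      exact (hr' t ht).congr_of_mem hgr ht
    intro t ht
    rcases lt_trichotomy t T with h1 | rfl | h1
    · refine (hA t ⟨ht.1, h1.le⟩).mono_of_mem_nhdsWithin
        (mem_of_superset (inter_mem_nhdsWithin _ (Iio_mem_nhds h1)) ?_)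
      exact fun u hu => ⟨hu.1.1, le_of_lt hu.2⟩
    · rw [← Icc_union_Icc_eq_Icc hT (by linarith : t ≤ t + T')]
      exact (hA t ⟨hT, le_rfl⟩).union (hB t ⟨le_rfl, ht.2⟩)
    · refine (hB t ⟨h1.le, ht.2⟩).mono_of_mem_nhdsWithin
        (mem_of_superset (inter_mem_nhdsWithin _ (Ioi_mem_nhds h1)) ?_)
      exact fun u hu => ⟨le_of_lt hu.2, hu.1.2⟩
  · intro t ht
    by_cases h1 : t ≤ T
    · rw [hgl ⟨ht.1, h1⟩]; exact hD t ⟨ht.1, h1⟩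
    · rw [hgr ⟨(not_le.1 h1).le, ht.2⟩]; exact hD' _ ⟨by linarith, by linarith [ht.2]⟩
  · rw [hgl ⟨le_rfl, hT⟩, h0]
  · rw [hgr ⟨by linarith, le_rfl⟩]; simpa using h1'

/-- A solution is determined by its initial value: both images are compact, so that the field is
Lipschitz on their union. -/
theorem IsSolutionOn.eqOn (hZ : ContDiff ℝ 1 Z) {γ γ' : ℝ → ℝ × ℝ} {T : ℝ}
    (h : IsSolutionOn Z γ (Icc 0 T)) (h' : IsSolutionOn Z γ' (Icc 0 T)) (h0 : γ 0 = γ' 0) :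
    EqOn γ γ' (Icc 0 T) := by
  have hc : IsCompact (γ '' Icc 0 T ∪ γ' '' Icc 0 T) :=
    (isCompact_Icc.image_of_continuousOn h.continuousOn).union
      (isCompact_Icc.image_of_continuousOn h'.continuousOn)
  obtain ⟨K, hK⟩ := (hZ.locallyLipschitz.locallyLipschitzOn
    (s := γ '' Icc 0 T ∪ γ' '' Icc 0 T)).exists_lipschitzOnWith_of_compact hc
  have key : ∀ g : ℝ → ℝ × ℝ, IsSolutionOn Z g (Icc 0 T) →
      ∀ t ∈ Ico 0 T, HasDerivWithinAt g (Z (g t)) (Ici t) t := by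
    intro g hg t ht
    refine (hg t ⟨ht.1, ht.2.le⟩).mono_of_mem_nhdsWithin ?_
    exact mem_of_superset (Icc_mem_nhdsGE ht.2) (Icc_subset_Icc_left ht.1)
  refine ODE_solution_unique_of_mem_Icc_right (v := fun _ => Z)
    (s := fun _ => γ '' Icc 0 T ∪ γ' '' Icc 0 T) (K := K) (fun _ _ => hK)
    h.continuousOn (key γ h) ?_ h'.continuousOn (key γ' h') ?_ h0
  · exact fun t ht => Or.inl ⟨t, ⟨ht.1, ht.2.le⟩, rfl⟩
  · exact fun t ht => Or.inr ⟨t, ⟨ht.1, ht.2.le⟩, rfl⟩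

/-- Of two forward arcs from the same point, one continues the other. -/
theorem Reach.or_of_left (hZ : ContDiff ℝ 1 Z) (h₁ : Reach Z D p q) (h₂ : Reach Z D p r) :
    Reach Z D q r ∨ Reach Z D r q := by
  wlog hTT : h₁.choose_spec.choose ≤ h₂.choose_spec.choose generalizing q r with H
  · exact (H h₂ h₁ (le_of_not_ge hTT)).symm
  obtain ⟨hT, h, hD, h0, h1⟩ := h₁.choose_spec.choose_spec
  obtain ⟨hT', h', hD', h0', h1'⟩ := h₂.choose_spec.choose_spec
  generalize h₁.choose_spec.choose = T at *
  generalize h₂.choose_spec.choose = T' at *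
  generalize h₁.choose = γ at *
  generalize h₂.choose = γ' at *
  left
  have := h.eqOn hZ (h'.mono (Icc_subset_Icc_right hTT)) (h0.trans h0'.symm) ⟨hT, le_rfl⟩
  rw [← h1, this, ← h1']
  exact Reach.of_Icc hTT (h'.mono (Icc_subset_Icc_left hT))
    fun t ht => hD' t ⟨hT.trans ht.1, ht.2⟩

theorem Reach.or_of_right (hZ : ContDiff ℝ 1 Z) (h₁ : Reach Z D p r) (h₂ : Reach Z D q r) :
    Reach Z D p q ∨ Reach Z D q p := by
  have := h₁.neg.or_of_left (D := D) (by exact hZ.neg) h₂.neg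
  rcases this with h | h
  · exact Or.inr (by simpa using h.neg)
  · exact Or.inl (by simpa using h.neg)

theorem joinedIn_refl (hp : p ∈ D) : JoinedIn Z D p p := joinedIn_iff.2 (Or.inl (Reach.refl hp))

theorem joinedIn_symm (h : JoinedIn Z D p q) : JoinedIn Z D q p :=
  joinedIn_iff.2 (joinedIn_iff.1 h).symm

/-- Transitivity needs uniqueness: two arcs that leave the common point in the same direction of time
overlap. -/
theorem joinedIn_trans (hZ : ContDiff ℝ 1 Z) (h₁ : JoinedIn Z D p q) (h₂ : JoinedIn Z D q r) :
    JoinedIn Z D p r := by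
  rw [joinedIn_iff] at *
  rcases h₁ with h₁ | h₁ <;> rcases h₂ with h₂ | h₂
  · exact Or.inl (h₁.trans h₂)
  · exact h₁.or_of_right hZ h₂
  · exact h₁.or_of_left hZ h₂
  · exact Or.inr (h₂.trans h₁)

/-- Forward in time, the passages through the line `x = x₀` are isolated in time wherever they are
transversal. Every time is considered with its own solution, which uniqueness makes irrelevant. -/
theorem countable_reach (hZ : ContDiff ℝ 1 Z) (p : ℝ × ℝ) (x₀ : ℝ) :
    {q | Reach Z univ p q ∧ q.1 = x₀ ∧ (Z q).1 ≠ 0}.Countable := by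
  set S : Set ℝ := {T | 0 ≤ T ∧ ∃ γ : ℝ → ℝ × ℝ, IsSolutionOn Z γ (Icc 0 T) ∧ γ 0 = p ∧
    (γ T).1 = x₀ ∧ (Z (γ T)).1 ≠ 0} with hS
  have hSc : S.Countable := by
    have hiso : ∀ T ∈ S, ∃ y < T, 0 < T → Disjoint (Ioo y T) S := by
      rintro T ⟨hT, γ, h, h0, hx, hne⟩
      rcases hT.eq_or_lt with rfl | hT'
      · exact ⟨-1, by norm_num, fun h => absurd h (lt_irrefl _)⟩
      have hd : HasDerivWithinAt (fun t => (γ t).1) (Z (γ T)).1 (Iio T) T := by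
        have := (h T ⟨hT, le_rfl⟩).mono_of_mem_nhdsWithin (s := Iio T)
          (mem_of_superset (Ioo_mem_nhdsLT hT') Ioo_subset_Icc_self)
        exact (hasFDerivAt_fst.comp_hasDerivWithinAt T this)
      have hev := hd.eventually_ne (c := x₀) hne
      have hev2 : ∀ᶠ t in 𝓝[<] T, (γ t).1 ≠ x₀ := by
        simpa using hev
      obtain ⟨y, hy, hy'⟩ := (mem_nhdsLT_iff_exists_Ioo_subset).1 (hev2)
      refine ⟨y, hy, fun _ => disjoint_left.2 ?_⟩
      rintro t ht ⟨ht0, γ', h', h0', hx', -⟩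
      have := h'.eqOn hZ (h.mono (Icc_subset_Icc_right ht.2.le)) (h0'.trans h0.symm) ⟨ht0, le_rfl⟩
      exact hy' ht (by rw [← this, hx'])
    choose! y hy hy' using hiso
    have : (S \ {0}).Countable := by
      have hneg : ((fun t => -t) '' (S \ {0})).Countable := by
        refine Set.PairwiseDisjoint.countable_of_Ioo (y := fun t => - y (-t)) ?_ ?_
        · rintro _ ⟨s, hs, rfl⟩ _ ⟨t, ht, rfl⟩ hst
          have hs0 : 0 < s := lt_of_le_of_ne hs.1.1 (Ne.symm hs.2)
          have ht0 : 0 < t := lt_of_le_of_ne ht.1.1 (Ne.symm ht.2)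
          refine disjoint_left.2 ?_
          intro u hu hv
          simp only [neg_neg, mem_Ioo] at hu hv
          rcases lt_trichotomy s t with h | h | h
          · exact disjoint_left.1 (hy' t ht.1 ht0) ⟨by linarith, h⟩ hs.1
          · exact hst (by rw [h])
          · exact disjoint_left.1 (hy' s hs.1 hs0) ⟨by linarith, h⟩ ht.1
        · rintro _ ⟨s, hs, rfl⟩
          simpa using hy s hs.1
      have := hneg.image (fun t => -t)
      simpa [image_image] using this
    exact this.of_sdiff (countable_singleton 0)
  have : ∀ q, Reach Z univ p q ∧ q.1 = x₀ ∧ (Z q).1 ≠ 0 → ∃ T ∈ S, ∃ γ : ℝ → ℝ × ℝ,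
      IsSolutionOn Z γ (Icc 0 T) ∧ γ 0 = p ∧ γ T = q := by
    rintro q ⟨⟨γ, T, hT, h, -, h0, h1⟩, hq, hne⟩
    exact ⟨T, ⟨hT, γ, h, h0, by rw [h1, hq], by rwa [h1]⟩, γ, h, h0, h1⟩
  choose! τ hτ γ hγ using this
  refine MapsTo.countable_of_injOn (f := τ) (t := S) (fun q hq => hτ q hq) ?_ hSc
  intro q hq q' hq' heq
  obtain ⟨h, h0, h1⟩ := hγ q hq
  obtain ⟨h', h0', h1'⟩ := hγ q' hq'
  rw [← h1, ← h1', ← heq]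
  rw [← heq] at h'
  exact h.eqOn hZ h' (h0.trans h0'.symm) ⟨(hτ q hq).1, le_rfl⟩

/-- Each orbit meets a vertical line, where it crosses it transversally, in countably many points. -/
theorem countable_joinedIn (hZ : ContDiff ℝ 1 Z) (p : ℝ × ℝ) (x₀ : ℝ) :
    {q | JoinedIn Z univ p q ∧ q.1 = x₀ ∧ (Z q).1 ≠ 0}.Countable := by
  refine ((countable_reach hZ p x₀).union (countable_reach (Z := -Z) (by exact hZ.neg) p x₀)).mono ?_
  rintro q ⟨h, hx, hne⟩
  rcases joinedIn_iff.1 h with h | h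
  · exact Or.inl ⟨h, hx, hne⟩
  · exact Or.inr ⟨h.neg, hx, by simpa using hne⟩

/-- The Picard-Lindelöf theorem for an autonomous field, with the ball that the solution stays in. -/
theorem exists_solution_mem_closedBall (hZ : ContDiff ℝ 1 Z) {a L T : ℝ} (ha : 0 ≤ a)
    (hL : 0 ≤ L) (hT : 0 ≤ T) (hb : ∀ q ∈ closedBall p a, ‖Z q‖ ≤ L) (hLT : L * T ≤ a) :
    ∃ γ : ℝ → ℝ × ℝ, IsSolutionOn Z γ (Icc 0 T) ∧ γ 0 = p ∧ ∀ t ∈ Icc 0 T, γ t ∈ closedBall p a := by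
  obtain ⟨K, hK⟩ := (hZ.locallyLipschitz.locallyLipschitzOn
    (s := closedBall p a)).exists_lipschitzOnWith_of_compact (isCompact_closedBall p a)
  lift a to NNReal using ha
  lift L to NNReal using hL
  obtain ⟨t₀, ht₀⟩ : ∃ t₀ : Icc (0 : ℝ) T, (t₀ : ℝ) = 0 := ⟨⟨0, le_rfl, hT⟩, rfl⟩
  have hpl : IsPicardLindelof (fun _ => Z) t₀ p a 0 L K := by
    refine IsPicardLindelof.of_time_independent hb hK ?_
    simpa [hT, ht₀] using hLT
  have hp : p ∈ closedBall p ((0 : NNReal) : ℝ) := mem_closedBall_self le_rfl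
  obtain ⟨α, hα⟩ := ODE.FunSpace.exists_isFixedPt_next hpl hp
  have hmem : ∀ t, α.compProj t ∈ closedBall p a :=
    fun t => α.compProj_mem_closedBall hpl.mul_max_le
  refine ⟨α.compProj, ?_, ?_, fun t _ => hmem t⟩
  · intro t ht
    refine (ODE.hasDerivWithinAt_picard_Icc t₀.2
      hpl.continuousOn_uncurry α.continuous_compProj.continuousOn (fun _ _ => hmem _) p ht
      ).congr_of_mem ?_ ht
    intro t' ht'
    nth_rw 1 [← hα]
    rw [ODE.FunSpace.compProj_of_mem ht', ODE.FunSpace.next_apply]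
  · have h0 : α.compProj t₀ = p := by
      rw [ODE.FunSpace.compProj_val, ← hα, ODE.FunSpace.next_apply₀]
    rwa [ht₀] at h0

end ODE

/-! ### Solutions near a point of the switching line, and visibility -/

section Visibility
variable {Z : ℝ × ℝ → ℝ × ℝ} {γ : ℝ → ℝ × ℝ} {I : Set ℝ} {s t x₀ : ℝ}

theorem IsSolutionOn.hasDerivAt_fst (h : IsSolutionOn Z γ I) (ht : I ∈ 𝓝 t) :
    HasDerivAt (fun t => (γ t).1) (Z (γ t)).1 t :=
  (ContinuousLinearMap.fst ℝ ℝ ℝ).hasFDerivAt.comp_hasDerivAt t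
    ((h t (mem_of_mem_nhds ht)).hasDerivAt ht)

theorem IsSolutionOn.hasDerivAt_snd (h : IsSolutionOn Z γ I) (ht : I ∈ 𝓝 t) :
    HasDerivAt (fun t => (γ t).2) (Z (γ t)).2 t :=
  (ContinuousLinearMap.snd ℝ ℝ ℝ).hasFDerivAt.comp_hasDerivAt t
    ((h t (mem_of_mem_nhds ht)).hasDerivAt ht)

theorem IsSolutionOn.fst_lt (h : IsSolutionOn Z γ (Icc s t)) (hst : s < t)
    (hpos : ∀ u ∈ Ioo s t, 0 < (Z (γ u)).1) : (γ s).1 < (γ t).1 := by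
  refine strictMonoOn_of_deriv_pos (f := fun u => (γ u).1) (convex_Icc s t)
    (continuous_fst.comp_continuousOn h.continuousOn) ?_ ⟨le_rfl, hst.le⟩ ⟨hst.le, le_rfl⟩ hst
  intro u hu
  rw [interior_Icc] at hu
  rw [(h.hasDerivAt_fst (Icc_mem_nhds hu.1 hu.2)).deriv]
  exact hpos u hu

theorem IsSolutionOn.snd_lt (h : IsSolutionOn Z γ (Icc s t)) (hst : s < t)
    (hpos : ∀ u ∈ Ioo s t, 0 < (Z (γ u)).2) : (γ s).2 < (γ t).2 := by
  refine strictMonoOn_of_deriv_pos (f := fun u => (γ u).2) (convex_Icc s t)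
    (continuous_snd.comp_continuousOn h.continuousOn) ?_ ⟨le_rfl, hst.le⟩ ⟨hst.le, le_rfl⟩ hst
  intro u hu
  rw [interior_Icc] at hu
  rw [(h.hasDerivAt_snd (Icc_mem_nhds hu.1 hu.2)).deriv]
  exact hpos u hu

theorem IsSolutionOn.snd_gt (h : IsSolutionOn Z γ (Icc s t)) (hst : s < t)
    (hneg : ∀ u ∈ Ioo s t, (Z (γ u)).2 < 0) : (γ t).2 < (γ s).2 := by
  refine strictAntiOn_of_deriv_neg (f := fun u => (γ u).2) (convex_Icc s t)
    (continuous_snd.comp_continuousOn h.continuousOn) ?_ ⟨le_rfl, hst.le⟩ ⟨hst.le, le_rfl⟩ hst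
  intro u hu
  rw [interior_Icc] at hu
  rw [(h.hasDerivAt_snd (Icc_mem_nhds hu.1 hu.2)).deriv]
  exact hneg u hu

/-- Near `(x₀, 0)` a solution that moves to the right stays where a local property holds, and it is to
the right of `x₀` exactly at positive times. -/
theorem IsSolutionOn.exists_local (hZ : Continuous Z) {τ : ℝ} (hτ : 0 < τ)
    (h : IsSolutionOn Z γ (Ioo (-τ) τ)) (h0 : γ 0 = (x₀, 0)) (h1 : 0 < (Z (x₀, 0)).1)
    {P : ℝ × ℝ → Prop} (hP : ∀ᶠ q in 𝓝 (x₀, 0), P q) :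
    ∃ σ > 0, σ ≤ τ ∧ (∀ t ∈ Ioo (-σ) σ, P (γ t)) ∧
      (∀ t ∈ Ioo (-σ) σ, 0 < t → x₀ < (γ t).1) ∧ (∀ t ∈ Ioo (-σ) σ, t < 0 → (γ t).1 < x₀) := by
  have hc : ContinuousAt γ 0 :=
    (h.continuousOn).continuousAt (Ioo_mem_nhds (by linarith) hτ)
  have hpos : ∀ᶠ q in 𝓝 (x₀, (0 : ℝ)), 0 < (Z q).1 :=
    (continuous_fst.comp hZ).continuousAt.eventually (lt_mem_nhds h1)
  rw [← h0] at hP hpos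
  obtain ⟨σ, hσ, hb⟩ := Metric.eventually_nhds_iff_ball.1 (hc.eventually (hP.and hpos))
  have hmem : ∀ t ∈ Ioo (-min σ τ) (min σ τ), P (γ t) ∧ 0 < (Z (γ t)).1 := by
    intro t ht
    apply hb
    rw [Real.ball_eq_Ioo]
    exact ⟨by linarith [ht.1, min_le_left σ τ], by linarith [ht.2, min_le_left σ τ]⟩
  refine ⟨min σ τ, lt_min hσ hτ, min_le_right _ _, fun t ht => (hmem t ht).1, ?_, ?_⟩
  · intro t ht ht0
    have := (h.mono (J := Icc 0 t) fun u hu => ⟨by linarith [hu.1],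
      by linarith [hu.2, ht.2, min_le_right σ τ]⟩).fst_lt ht0 fun u hu =>
        (hmem u ⟨by linarith [hu.1, hu.2, ht.1, ht.2], by linarith [hu.1, hu.2, ht.1, ht.2]⟩).2
    simpa [h0] using this
  · intro t ht ht0
    have := (h.mono (J := Icc t 0) fun u hu => ⟨by linarith [hu.1, ht.1, min_le_right σ τ],
      by linarith [hu.2]⟩).fst_lt ht0 fun u hu =>
        (hmem u ⟨by linarith [hu.1, hu.2, ht.1, ht.2], by linarith [hu.1, hu.2, ht.1, ht.2]⟩).2
    simpa [h0] using this

theorem exists_solution_Ioo (hZ : ContDiff ℝ 1 Z) (p : ℝ × ℝ) :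
    ∃ τ > 0, ∃ γ : ℝ → ℝ × ℝ, IsSolutionOn Z γ (Ioo (-τ) τ) ∧ γ 0 = p := by
  obtain ⟨γ, h0, τ, hτ, h⟩ :=
    hZ.contDiffAt.exists_forall_mem_closedBall_exists_eq_forall_mem_Ioo_hasDerivAt₀ (x₀ := p) 0
  exact ⟨τ, hτ, γ, fun t ht => (h t (by simpa using ht)).hasDerivWithinAt, h0⟩

theorem rightSegmentAbove_of_pos (hZ : ContDiff ℝ 1 Z) (h1 : 0 < (Z (x₀, 0)).1)
    (h : ∀ᶠ q in 𝓝 (x₀, (0 : ℝ)), x₀ < q.1 → 0 < (Z q).2) : RightSegmentAbove Z x₀ := by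
  obtain ⟨τ, hτ, γ, hγ, h0⟩ := exists_solution_Ioo hZ (x₀, 0)
  obtain ⟨σ, hσ, hστ, hP, hr, hl⟩ := hγ.exists_local hZ.continuous hτ h0 h1 h
  refine ⟨σ, hσ, γ, hγ.mono (Ioo_subset_Ioo (by linarith) hστ), h0, fun t ht hx => ?_⟩
  have ht0 : 0 < t := by
    rcases lt_trichotomy t 0 with h | rfl | h
    · exact absurd hx (hl t ht h).le.not_gt
    · simp [h0] at hx
    · exact h
  have := (hγ.mono (J := Icc 0 t) fun u hu => ⟨by linarith [hu.1], by linarith [hu.2, ht.2]⟩).snd_lt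
    ht0 fun u hu => hP u ⟨by linarith [hu.1], by linarith [hu.2, ht.2]⟩
      (hr u ⟨by linarith [hu.1], by linarith [hu.2, ht.2]⟩ hu.1)
  simpa [h0] using this

theorem leftSegmentAbove_of_neg (hZ : ContDiff ℝ 1 Z) (h1 : 0 < (Z (x₀, 0)).1)
    (h : ∀ᶠ q in 𝓝 (x₀, (0 : ℝ)), q.1 < x₀ → (Z q).2 < 0) : LeftSegmentAbove Z x₀ := by
  obtain ⟨τ, hτ, γ, hγ, h0⟩ := exists_solution_Ioo hZ (x₀, 0)
  obtain ⟨σ, hσ, hστ, hP, hr, hl⟩ := hγ.exists_local hZ.continuous hτ h0 h1 h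
  refine ⟨σ, hσ, γ, hγ.mono (Ioo_subset_Ioo (by linarith) hστ), h0, fun t ht hx => ?_⟩
  have ht0 : t < 0 := by
    rcases lt_trichotomy t 0 with h | rfl | h
    · exact h
    · simp [h0] at hx
    · exact absurd hx (hr t ht h).le.not_gt
  have := (hγ.mono (J := Icc t 0) fun u hu => ⟨by linarith [hu.1, ht.1], by linarith [hu.2]⟩).snd_gt
    ht0 fun u hu => hP u ⟨by linarith [hu.1, ht.1], by linarith [hu.2]⟩
      (hl u ⟨by linarith [hu.1, ht.1], by linarith [hu.2]⟩ hu.2)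
  simpa [h0] using this

theorem not_rightSegmentAbove_of_neg (hZ : Continuous Z) (h1 : 0 < (Z (x₀, 0)).1)
    (h : ∀ᶠ q in 𝓝 (x₀, (0 : ℝ)), x₀ < q.1 → (Z q).2 < 0) : ¬ RightSegmentAbove Z x₀ := by
  rintro ⟨τ, hτ, γ, hγ, h0, habove⟩
  obtain ⟨σ, hσ, hστ, hP, hr, -⟩ := hγ.exists_local hZ hτ h0 h1 h
  have := (hγ.mono (J := Icc 0 (σ / 2)) fun u hu => ⟨by linarith [hu.1], by linarith [hu.2]⟩).snd_gt
    (by linarith) fun u hu => hP u ⟨by linarith [hu.1], by linarith [hu.2]⟩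
      (hr u ⟨by linarith [hu.1], by linarith [hu.2]⟩ hu.1)
  have h2 := habove (σ / 2) ⟨by linarith, by linarith⟩
    (hr _ ⟨by linarith, by linarith⟩ (by linarith))
  rw [h0] at this
  exact lt_asymm this h2

theorem not_leftSegmentAbove_of_pos (hZ : Continuous Z) (h1 : 0 < (Z (x₀, 0)).1)
    (h : ∀ᶠ q in 𝓝 (x₀, (0 : ℝ)), q.1 < x₀ → 0 < (Z q).2) : ¬ LeftSegmentAbove Z x₀ := by
  rintro ⟨τ, hτ, γ, hγ, h0, habove⟩
  obtain ⟨σ, hσ, hστ, hP, -, hl⟩ := hγ.exists_local hZ hτ h0 h1 h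
  have := (hγ.mono (J := Icc (-(σ / 2)) 0) fun u hu =>
    ⟨by linarith [hu.1], by linarith [hu.2]⟩).snd_lt
    (by linarith) fun u hu => hP u ⟨by linarith [hu.1], by linarith [hu.2]⟩
      (hl u ⟨by linarith [hu.1], by linarith [hu.2]⟩ hu.2)
  have h2 := habove (-(σ / 2)) ⟨by linarith, by linarith⟩
    (hl _ ⟨by linarith, by linarith⟩ (by linarith))
  rw [h0] at this
  exact lt_asymm this h2

end Visibility

/-! ### Reversal of time -/

section Reversal
variable {Z : ℝ × ℝ → ℝ × ℝ} {D Γ : Set (ℝ × ℝ)} {p q : ℝ × ℝ} {x₀ : ℝ}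

theorem isTangentPoint_neg : IsTangentPoint (-Z) x₀ ↔ IsTangentPoint Z x₀ := by
  simp [IsTangentPoint]

theorem LeftSegmentAbove.neg (h : LeftSegmentAbove Z x₀) : LeftSegmentAbove (-Z) x₀ := by
  obtain ⟨τ, hτ, γ, hγ, h0, ha⟩ := h
  refine ⟨τ, hτ, fun t => γ (0 - t), (hγ.comp_const_sub 0).mono ?_, by simpa, fun t ht => ha _ ?_⟩
  · intro t ht; simp only [mem_preimage, mem_Ioo] at *; constructor <;> linarith
  · simp only [mem_Ioo] at *; constructor <;> linarith

theorem RightSegmentAbove.neg (h : RightSegmentAbove Z x₀) : RightSegmentAbove (-Z) x₀ := by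
  obtain ⟨τ, hτ, γ, hγ, h0, ha⟩ := h
  refine ⟨τ, hτ, fun t => γ (0 - t), (hγ.comp_const_sub 0).mono ?_, by simpa, fun t ht => ha _ ?_⟩
  · intro t ht; simp only [mem_preimage, mem_Ioo] at *; constructor <;> linarith
  · simp only [mem_Ioo] at *; constructor <;> linarith

theorem leftSegmentAbove_neg : LeftSegmentAbove (-Z) x₀ ↔ LeftSegmentAbove Z x₀ :=
  ⟨fun h => by simpa using h.neg, fun h => h.neg⟩

theorem rightSegmentAbove_neg : RightSegmentAbove (-Z) x₀ ↔ RightSegmentAbove Z x₀ :=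
  ⟨fun h => by simpa using h.neg, fun h => h.neg⟩

theorem isVisible_neg :
    TangentBifurcation.IsVisible (-Z) x₀ ↔ TangentBifurcation.IsVisible Z x₀ := by
  simp only [TangentBifurcation.IsVisible, isTangentPoint_neg, leftSegmentAbove_neg,
    rightSegmentAbove_neg]

theorem isInvisible_neg : IsInvisible (-Z) x₀ ↔ IsInvisible Z x₀ := by
  simp only [IsInvisible, isTangentPoint_neg, leftSegmentAbove_neg, rightSegmentAbove_neg]

theorem isLeft_neg : IsLeft (-Z) x₀ ↔ IsLeft Z x₀ := by
  simp only [IsLeft, isTangentPoint_neg, leftSegmentAbove_neg, rightSegmentAbove_neg]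

theorem isRight_neg : IsRight (-Z) x₀ ↔ IsRight Z x₀ := by
  simp only [IsRight, isTangentPoint_neg, leftSegmentAbove_neg, rightSegmentAbove_neg]

theorem joinedIn_neg : JoinedIn (-Z) D p q ↔ JoinedIn Z D p q := by
  have key : ∀ {Z : ℝ × ℝ → ℝ × ℝ}, JoinedIn Z D p q → JoinedIn (-Z) D p q := by
    intro Z h
    rw [joinedIn_iff] at *
    exact h.symm.imp Reach.neg Reach.neg
  exact ⟨fun h => by simpa using key h, key⟩

theorem isOrbitSegment_neg : IsOrbitSegment (-Z) D Γ ↔ IsOrbitSegment Z D Γ := by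
  simp only [IsOrbitSegment, joinedIn_neg]

theorem visiblePointsOn_neg (r : ℝ) : visiblePointsOn (-Z) r Γ = visiblePointsOn Z r Γ := by
  simp only [visiblePointsOn, isVisible_neg]

variable {f φ : ℝ × ℝ → ℝ} {m : ℕ}

theorem upperField_neg : upperField (-f) (-φ) m = -upperField f φ m := by
  funext p; simp [upperField]

theorem unfoldedField_neg (lam : Fin m → ℝ) (ψ : ℝ → ℝ) :
    unfoldedField (-f) (-φ) lam ψ = -unfoldedField f φ lam ψ := by
  funext p
  simp only [unfoldedField, Pi.neg_apply, Prod.neg_mk, Prod.mk.injEq, true_and]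
  ring

theorem C1Close.neg {ε : ℝ} {U : Set (ℝ × ℝ)} {X Y : ℝ × ℝ → ℝ} (h : C1Close ε U X Y) :
    C1Close ε U (fun p => -X p) (fun p => -Y p) := by
  intro p hp
  have e : ∀ a b : ℝ, -a - -b = -(a - b) := fun a b => by ring
  simpa only [e, abs_neg, deriv.fun_neg] using h p hp

theorem HasBifurcatingTangentOrbits.of_neg {U : Set (ℝ × ℝ)} {r₁ r₂ : ℝ} {ℓ n : ℕ}
    (h : HasBifurcatingTangentOrbits (-f) (-φ) m U r₁ r₂ ℓ n) :
    HasBifurcatingTangentOrbits f φ m U r₁ r₂ ℓ n := by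
  obtain ⟨d, hd, r, hr, h⟩ := h
  refine ⟨d, hd, r, hr, fun ε hε => ?_⟩
  obtain ⟨lam, k, h1, h2, h3, h4, h5, h6, h7⟩ := h ε hε
  simp only [unfoldedField_neg, upperField_neg, isTangentPoint_neg, isOrbitSegment_neg,
    visiblePointsOn_neg] at h4 h5 h6 h7
  exact ⟨lam, k, h1, h2, h3, by simpa using h4.neg, by simpa using h5.neg, h6, h7⟩

end Reversal

/-! ### The cutoff functions and bounds for their derivatives -/

section Cutoff
variable {a b c x : ℝ}

theorem cutoff_denom_pos (hab : a < b) (x : ℝ) :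
    0 < expNegInvGlue (x - a) + expNegInvGlue (b - x) := by
  rcases lt_or_ge a x with h | h
  · exact add_pos_of_pos_of_nonneg (expNegInvGlue.pos_of_pos (by linarith)) (expNegInvGlue.nonneg _)
  · exact add_pos_of_nonneg_of_pos (expNegInvGlue.nonneg _)
      (expNegInvGlue.pos_of_pos (by linarith))

/-- Multiplying numerator and denominator by `exp (-1 / (x - a))` gives a formula that is valid on the
whole line and shows smoothness. -/
theorem cutoffUp_eq (x : ℝ) :
    cutoffUp a b x = expNegInvGlue (x - a) / (expNegInvGlue (x - a) + expNegInvGlue (b - x)) := by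
  unfold cutoffUp
  split_ifs with h1 h2
  · simp [expNegInvGlue.zero_of_nonpos (by linarith : x - a ≤ 0)]
  · have h1' : 0 < x - a := by linarith
    have h2' : 0 < b - x := by linarith
    have e : Real.exp (eta a b x) = expNegInvGlue (b - x) / expNegInvGlue (x - a) := by
      rw [expNegInvGlue, expNegInvGlue, if_neg h1'.not_ge, if_neg h2'.not_ge, ← Real.exp_sub, eta]
      congr 1
      rw [← neg_sub b x]
      field_simp
      ring
    have := (expNegInvGlue.pos_of_pos h1').ne'
    rw [e]
    field_simp
  · have h2' : expNegInvGlue (b - x) = 0 := expNegInvGlue.zero_of_nonpos (by linarith)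
    have h1' := (expNegInvGlue.pos_of_pos (by linarith : 0 < x - a)).ne'
    rw [h2', add_zero, div_self h1']

theorem cutoffDown_eq (x : ℝ) : cutoffDown a b x = 1 - cutoffUp a b x := by
  have := Real.exp_pos (eta a b x)
  unfold cutoffDown cutoffUp
  split_ifs
  · simp
  · field_simp; ring
  · simp

theorem cutoffUp_of_le (h : x ≤ a) : cutoffUp a b x = 0 := by simp [cutoffUp, h]

theorem cutoffUp_of_ge (hab : a < b) (h : b ≤ x) : cutoffUp a b x = 1 := by
  simp [cutoffUp, (hab.trans_le h).not_ge, h.not_gt]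

theorem cutoffUp_nonneg : 0 ≤ cutoffUp a b x := by
  have := Real.exp_pos (eta a b x)
  unfold cutoffUp; split_ifs <;> positivity

theorem cutoffUp_le_one : cutoffUp a b x ≤ 1 := by
  have := Real.exp_pos (eta a b x)
  unfold cutoffUp; split_ifs
  · simp
  · rw [div_le_one (by positivity)]; linarith
  · simp

theorem bump_eq (hab : a < b) (hbc : b < c) (x : ℝ) :
    bump a b c x = cutoffUp a b x - cutoffUp b c x := by
  unfold bump
  split_ifs with h1 h2
  · rw [cutoffUp_of_le h1.2, sub_zero]
  · rw [cutoffDown_eq, cutoffUp_of_ge hab h2.1.le]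
  · rcases le_or_gt x a with h | h
    · rw [cutoffUp_of_le h, cutoffUp_of_le (h.trans hab.le), sub_zero]
    · have hbx : b < x := not_le.1 fun h' => h1 ⟨h, h'⟩
      have hcx : c < x := not_le.1 fun h' => h2 ⟨hbx, h'⟩
      rw [cutoffUp_of_ge hab hbx.le, cutoffUp_of_ge hbc hcx.le, sub_self]

theorem contDiff_cutoffUp (hab : a < b) : ContDiff ℝ ∞ (cutoffUp a b) := by
  have e : cutoffUp a b =
      fun x => expNegInvGlue (x - a) / (expNegInvGlue (x - a) + expNegInvGlue (b - x)) :=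
    funext cutoffUp_eq
  rw [e]
  have h1 : ContDiff ℝ ∞ fun x : ℝ => expNegInvGlue (x - a) :=
    expNegInvGlue.contDiff.comp (contDiff_id.sub contDiff_const)
  have h2 : ContDiff ℝ ∞ fun x : ℝ => expNegInvGlue (b - x) :=
    expNegInvGlue.contDiff.comp (contDiff_const.sub contDiff_id)
  exact h1.div (h1.add h2) fun x => (cutoff_denom_pos hab x).ne'

theorem monotone_cutoffUp (hab : a < b) : Monotone (cutoffUp a b) := by
  intro x y hxy
  rw [cutoffUp_eq, cutoffUp_eq, div_le_div_iff₀ (cutoff_denom_pos hab x)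
    (cutoff_denom_pos hab y)]
  have h1 := expNegInvGlue.monotone (by linarith : x - a ≤ y - a)
  have h2 := expNegInvGlue.monotone (by linarith : b - y ≤ b - x)
  have := mul_le_mul h1 h2 (expNegInvGlue.nonneg _) (expNegInvGlue.nonneg _)
  nlinarith

theorem continuous_deriv_cutoffUp (hab : a < b) : Continuous (deriv (cutoffUp a b)) :=
  (contDiff_cutoffUp hab).continuous_deriv (by simp)

theorem continuous_deriv_deriv_cutoffUp (hab : a < b) :
    Continuous (deriv (deriv (cutoffUp a b))) := by
  have h : ContDiff ℝ 1 (deriv (cutoffUp a b)) :=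
    ((contDiff_succ_iff_deriv (n := 1)).1 ((contDiff_cutoffUp hab).of_le (by norm_cast))).2.2
  exact h.continuous_deriv le_rfl

theorem deriv_cutoffUp_nonneg (hab : a < b) : 0 ≤ deriv (cutoffUp a b) x :=
  (monotone_cutoffUp hab).deriv_nonneg

theorem cutoffUp_eventuallyEq_const (hab : a < b) (hx : x ∉ Icc a b) :
    ∃ v : ℝ, cutoffUp a b =ᶠ[𝓝 x] fun _ => v := by
  rcases lt_or_ge x a with h | h
  · exact ⟨0, by filter_upwards [Iio_mem_nhds h] with y hy using cutoffUp_of_le (le_of_lt hy)⟩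
  · have : b < x := not_le.1 fun h' => hx ⟨h, h'⟩
    exact ⟨1, by filter_upwards [Ioi_mem_nhds this] with y hy using cutoffUp_of_ge hab (le_of_lt hy)⟩

theorem deriv_cutoffUp_of_notMem (hab : a < b) (hx : x ∉ Ioo a b) :
    deriv (cutoffUp a b) x = 0 := by
  have h0 : ∀ y, y ∉ Icc a b → deriv (cutoffUp a b) y = 0 := by
    intro y hy
    obtain ⟨v, hv⟩ := cutoffUp_eventuallyEq_const hab hy
    rw [hv.deriv_eq]; simp
  have hcl : IsClosed {y | deriv (cutoffUp a b) y = 0} :=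
    isClosed_eq (continuous_deriv_cutoffUp hab) continuous_const
  rcases le_or_gt x a with h | h
  · have : closure (Iio a) ⊆ {y | deriv (cutoffUp a b) y = 0} :=
      hcl.closure_subset_iff.2 fun y hy => h0 y fun h => h.1.not_gt hy
    rw [closure_Iio] at this
    exact this h
  · have hb : b ≤ x := not_lt.1 fun h' => hx ⟨h, h'⟩
    have : closure (Ioi b) ⊆ {y | deriv (cutoffUp a b) y = 0} :=
      hcl.closure_subset_iff.2 fun y hy => h0 y fun h => h.2.not_gt hy
    rw [closure_Ioi] at this
    exact this hb

theorem pow_four_mul_exp_le {M m : ℝ} (hmM : m ≤ M) :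
    M ^ 4 * Real.exp (-(M - m)) ≤ 8 * (m ^ 4 + 24) := by
  set η := M - m with hη
  have hη0 : 0 ≤ η := by linarith
  have h1 : η ^ 4 ≤ 24 * Real.exp η := by
    have := Real.pow_div_factorial_le_exp η hη0 4
    rw [div_le_iff₀ (by positivity)] at this
    norm_num [Nat.factorial] at this
    linarith
  have h2 : M ^ 4 ≤ 8 * (m ^ 4 + η ^ 4) := by
    rw [show M = m + η by rw [hη]; ring]
    nlinarith [sq_nonneg (m - η), sq_nonneg (m ^ 2 - η ^ 2),
      mul_nonneg (sq_nonneg (m - η)) (sq_nonneg (m + η)), sq_nonneg ((m - η) ^ 2)]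
  rw [Real.exp_neg, ← div_eq_mul_inv, div_le_iff₀ (Real.exp_pos _)]
  have h3 : 1 ≤ Real.exp η := Real.one_le_exp hη0
  have : m ^ 4 ≤ m ^ 4 * Real.exp η := le_mul_of_one_le_right (by positivity) h3
  linarith

/-- With `t = x - a` and `u = b - x`, the derivatives of the cutoff up to order two are at most
`8 max (1 / t) (1 / u) ^ 4 * exp (-|η|)`; the exponential factor absorbs what exceeds the fourth
power of `1 / (b - a)`. -/
theorem cutoff_weight_le {t u : ℝ} (ht : 0 < t) (hu : 0 < u) (htu : t + u ≤ 1) :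
    (2 * (1 / t ^ 3 + 1 / u ^ 3) + (1 / t ^ 2 + 1 / u ^ 2) ^ 2) * Real.exp (-|1 / t - 1 / u|) ≤
      2560 / (t + u) ^ 4 := by
  wlog h : t ≤ u generalizing t u with H
  · have := H hu ht (by linarith) (le_of_not_ge h)
    rw [abs_sub_comm, add_comm (1 / t ^ 3), add_comm (1 / t ^ 2), add_comm t]
    exact this
  set τ := 1 / t with hτ
  set υ := 1 / u with hυ
  have hτυ : υ ≤ τ := one_div_le_one_div_of_le ht h
  have hυ0 : 0 < υ := by positivity
  have hτ1 : 1 ≤ τ := by rw [hτ, le_div_iff₀ ht]; linarith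
  have hυw : υ ≤ 2 / (t + u) := by
    rw [hυ, div_le_div_iff₀ hu (by positivity)]; linarith
  have e : 2 * (1 / t ^ 3 + 1 / u ^ 3) + (1 / t ^ 2 + 1 / u ^ 2) ^ 2 =
      2 * (τ ^ 3 + υ ^ 3) + (τ ^ 2 + υ ^ 2) ^ 2 := by simp [hτ, hυ]
  rw [e, abs_of_nonneg (by linarith)]
  have h1 : 2 * (τ ^ 3 + υ ^ 3) + (τ ^ 2 + υ ^ 2) ^ 2 ≤ 8 * τ ^ 4 := by
    have a3 : υ ^ 3 ≤ τ ^ 3 := by gcongr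
    have a2 : υ ^ 2 ≤ τ ^ 2 := by gcongr
    have a4 : τ ^ 3 ≤ τ ^ 4 := pow_le_pow_right₀ hτ1 (by norm_num)
    have : (τ ^ 2 + υ ^ 2) ^ 2 ≤ (2 * τ ^ 2) ^ 2 := by gcongr; linarith
    nlinarith
  have h2 := pow_four_mul_exp_le hτυ
  have h3 : υ ^ 4 ≤ 16 / (t + u) ^ 4 := by
    calc υ ^ 4 ≤ (2 / (t + u)) ^ 4 := by gcongr
      _ = 16 / (t + u) ^ 4 := by rw [div_pow]; norm_num
  have h4 : 1 ≤ 1 / (t + u) ^ 4 := by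
    rw [le_div_iff₀ (by positivity), one_mul]; exact pow_le_one₀ (by positivity) htu
  calc _ ≤ 8 * τ ^ 4 * Real.exp (-(τ - υ)) := by gcongr
    _ = 8 * (τ ^ 4 * Real.exp (-(τ - υ))) := by ring
    _ ≤ 8 * (8 * (16 / (t + u) ^ 4 + 24 * (1 / (t + u) ^ 4))) := by linarith
    _ = 2560 / (t + u) ^ 4 := by ring

theorem exp_div_sq_le (η : ℝ) : Real.exp η / (1 + Real.exp η) ^ 2 ≤ Real.exp (-|η|) := by
  have h0 := Real.exp_pos η
  rcases le_total 0 η with h | h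
  · rw [abs_of_nonneg h, Real.exp_neg, div_le_iff₀ (by positivity)]
    field_simp
    nlinarith
  · rw [abs_of_nonpos h, neg_neg, div_le_iff₀ (by positivity)]
    nlinarith [mul_pos h0 h0]

theorem hasDerivAt_eta (hx : x ∈ Ioo a b) :
    HasDerivAt (eta a b) (-(1 / (x - a) ^ 2 + 1 / (b - x) ^ 2)) x := by
  have h1 : x - a ≠ 0 := by linarith [hx.1]
  have h2 : x - b ≠ 0 := by linarith [hx.2]
  have := (((hasDerivAt_id x).sub_const a).fun_inv h1).add (((hasDerivAt_id x).sub_const b).fun_inv h2)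
  have e : (eta a b) = ((fun y => (id y - a)⁻¹) + fun y => (id y - b)⁻¹) := by
    funext y; simp [eta]
  rw [e]
  have e' : -(1 / (x - a) ^ 2 + 1 / (b - x) ^ 2) = -1 / (id x - a) ^ 2 + -1 / (id x - b) ^ 2 := by
    rw [← neg_sub x b, neg_sq, id]
    ring
  rw [e']
  exact this

theorem deriv_cutoffUp_of_mem (hx : x ∈ Ioo a b) :
    deriv (cutoffUp a b) x = (1 / (x - a) ^ 2 + 1 / (b - x) ^ 2) *
      (Real.exp (eta a b x) / (1 + Real.exp (eta a b x)) ^ 2) := by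
  have hev : cutoffUp a b =ᶠ[𝓝 x] fun y => (1 + Real.exp (eta a b y))⁻¹ := by
    filter_upwards [Ioo_mem_nhds hx.1 hx.2] with y hy
    simp [cutoffUp, hy.1, hy.2]
  have hp := Real.exp_pos (eta a b x)
  have := ((hasDerivAt_eta hx).exp.const_add 1).fun_inv (by positivity)
  rw [hev.deriv_eq, this.deriv]
  ring

theorem deriv_deriv_cutoffUp_of_mem (hx : x ∈ Ioo a b) :
    deriv (deriv (cutoffUp a b)) x =
      (-2 / (x - a) ^ 3 + 2 / (b - x) ^ 3) *
        (Real.exp (eta a b x) / (1 + Real.exp (eta a b x)) ^ 2) +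
      (1 / (x - a) ^ 2 + 1 / (b - x) ^ 2) ^ 2 *
        (Real.exp (eta a b x) / (1 + Real.exp (eta a b x)) ^ 2) *
        ((Real.exp (eta a b x) - 1) / (1 + Real.exp (eta a b x))) := by
  have hev : deriv (cutoffUp a b) =ᶠ[𝓝 x] fun y => (((y - a) ^ 2)⁻¹ + ((b - y) ^ 2)⁻¹) *
      (Real.exp (eta a b y) / (1 + Real.exp (eta a b y)) ^ 2) := by
    filter_upwards [Ioo_mem_nhds hx.1 hx.2] with y hy
    rw [deriv_cutoffUp_of_mem hy, one_div, one_div]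
  have h1 : x - a ≠ 0 := by linarith [hx.1]
  have h2 : b - x ≠ 0 := by linarith [hx.2]
  have hp := Real.exp_pos (eta a b x)
  have hE := (hasDerivAt_eta hx).exp
  have hA := ((((hasDerivAt_id x).sub_const a).fun_pow 2).fun_inv (pow_ne_zero 2 h1)).fun_add
    ((((hasDerivAt_id x).const_sub b).fun_pow 2).fun_inv (pow_ne_zero 2 h2))
  have hB := hE.fun_div ((hE.const_add 1).fun_pow 2) (by positivity)
  have := hA.fun_mul hB
  rw [hev.deriv_eq]
  simp only [id] at this
  rw [this.deriv]
  field_simp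
  ring

theorem eta_eq (x : ℝ) : eta a b x = 1 / (x - a) - 1 / (b - x) := by
  rw [eta, ← neg_sub b x, div_neg]; ring

theorem abs_deriv_cutoffUp_le (hab : a < b) (h1 : b - a ≤ 1) (x : ℝ) :
    |deriv (cutoffUp a b) x| ≤ 2560 / (b - a) ^ 4 := by
  by_cases hx : x ∈ Ioo a b
  · have ht : 0 < x - a := by linarith [hx.1]
    have hu : 0 < b - x := by linarith [hx.2]
    have hw := cutoff_weight_le ht hu (by linarith)
    rw [show x - a + (b - x) = b - a by ring, ← eta_eq] at hw
    have hs := exp_div_sq_le (eta a b x)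
    rw [deriv_cutoffUp_of_mem hx, abs_of_nonneg (by positivity)]
    refine le_trans ?_ hw
    have ha : 1 ≤ 1 / (x - a) ^ 2 := by
      rw [le_div_iff₀ (by positivity), one_mul]
      exact pow_le_one₀ ht.le (by linarith [hx.2])
    have hb : 0 < 1 / (b - x) ^ 2 := by positivity
    have : 1 / (x - a) ^ 2 + 1 / (b - x) ^ 2 ≤ 2 * (1 / (x - a) ^ 3 + 1 / (b - x) ^ 3) +
        (1 / (x - a) ^ 2 + 1 / (b - x) ^ 2) ^ 2 := by
      have : 0 < 2 * (1 / (x - a) ^ 3 + 1 / (b - x) ^ 3) := by positivity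
      nlinarith
    gcongr
  · rw [deriv_cutoffUp_of_notMem hab hx, abs_zero]
    have : 0 < b - a := by linarith
    positivity

/-- The transition of the cutoff takes place on a length of order `(b - a) ^ 2`, hence the fourth
power in the bound for the second derivative. -/
theorem abs_deriv_deriv_cutoffUp_le (hab : a < b) (h1 : b - a ≤ 1) (x : ℝ) :
    |deriv (deriv (cutoffUp a b)) x| ≤ 2560 / (b - a) ^ 4 := by
  have hcl : IsClosed {y | |deriv (deriv (cutoffUp a b)) y| ≤ 2560 / (b - a) ^ 4} :=
    isClosed_le (continuous_deriv_deriv_cutoffUp hab).abs continuous_const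
  have hd : Dense ({a, b}ᶜ : Set ℝ) := (toFinite ({a, b} : Set ℝ)).countable.dense_compl ℝ
  have hsub : ({a, b}ᶜ : Set ℝ) ⊆ {y | |deriv (deriv (cutoffUp a b)) y| ≤ 2560 / (b - a) ^ 4} := by
    intro x hx'
    by_cases hx : x ∈ Ioo a b
    · have ht : 0 < x - a := by linarith [hx.1]
      have hu : 0 < b - x := by linarith [hx.2]
      have hw := cutoff_weight_le ht hu (by linarith)
      rw [show x - a + (b - x) = b - a by ring, ← eta_eq] at hw
      have hs := exp_div_sq_le (eta a b x)
      have hp := Real.exp_pos (eta a b x)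
      rw [mem_ofPred_eq, deriv_deriv_cutoffUp_of_mem hx]
      refine le_trans ?_ hw
      have e1 : |-2 / (x - a) ^ 3 + 2 / (b - x) ^ 3| ≤ 2 * (1 / (x - a) ^ 3 + 1 / (b - x) ^ 3) := by
        have : 0 < 1 / (x - a) ^ 3 := by positivity
        have : 0 < 1 / (b - x) ^ 3 := by positivity
        rw [abs_le]
        rw [neg_div, ← mul_one_div 2 ((x - a) ^ 3), ← mul_one_div 2 ((b - x) ^ 3)]
        constructor <;> linarith
      have e2 : |(Real.exp (eta a b x) - 1) / (1 + Real.exp (eta a b x))| ≤ 1 := by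
        rw [abs_div, abs_of_pos (by positivity : 0 < 1 + Real.exp (eta a b x)),
          div_le_one (by positivity), abs_le]
        constructor <;> linarith
      have e0 : 0 ≤ Real.exp (eta a b x) / (1 + Real.exp (eta a b x)) ^ 2 := by positivity
      calc _ ≤ |-2 / (x - a) ^ 3 + 2 / (b - x) ^ 3| *
            (Real.exp (eta a b x) / (1 + Real.exp (eta a b x)) ^ 2) +
            (1 / (x - a) ^ 2 + 1 / (b - x) ^ 2) ^ 2 *
            (Real.exp (eta a b x) / (1 + Real.exp (eta a b x)) ^ 2) *
            |(Real.exp (eta a b x) - 1) / (1 + Real.exp (eta a b x))| := by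
            refine (abs_add_le _ _).trans (le_of_eq ?_)
            simp only [abs_mul]
            rw [abs_of_nonneg e0,
              abs_of_nonneg (a := (1 / (x - a) ^ 2 + 1 / (b - x) ^ 2) ^ 2) (sq_nonneg _)]
        _ ≤ (2 * (1 / (x - a) ^ 3 + 1 / (b - x) ^ 3)) * Real.exp (-|eta a b x|) +
            (1 / (x - a) ^ 2 + 1 / (b - x) ^ 2) ^ 2 * Real.exp (-|eta a b x|) * 1 := by
            gcongr
        _ = _ := by ring
    · have hx2 : x ∉ Icc a b := by
        intro h
        simp only [mem_compl_iff, mem_insert_iff, mem_singleton_iff, not_or] at hx'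
        exact hx ⟨lt_of_le_of_ne h.1 (Ne.symm hx'.1), lt_of_le_of_ne h.2 hx'.2⟩
      obtain ⟨v, hv⟩ := cutoffUp_eventuallyEq_const hab hx2
      have : 0 < b - a := by linarith
      rw [mem_ofPred_eq, hv.deriv.deriv_eq]
      simp only [deriv_const', abs_zero]
      positivity
  have := hcl.closure_subset_iff.2 hsub
  rw [hd.closure_eq] at this
  exact this (mem_univ x)

end Cutoff

/-! ### Equidistant bumps -/

/-- The `i`-th node (counted from `0`) of the equidistant grid with step `s`, shifted so that node
`1` is `e * s`. -/
def gridPt (e : ℕ) (s : ℝ) (i : ℕ) : ℝ := s * ((i : ℝ) + e - 1)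

/-- The parameter vector with `2 N + 1` equidistant nodes and amplitudes `A`. -/
def gridParams (e : ℕ) (s : ℝ) {N : ℕ} (A : Fin N → ℝ) (i : Fin (3 * N + 1)) : ℝ :=
  if h : (i : ℕ) < 2 * N + 1 then gridPt e s i
  else A ⟨i - (2 * N + 1), by have := i.isLt; omega⟩

/-- The sum of bumps of amplitudes `A` centred at the odd nodes of the grid. -/
def bumpSum (e : ℕ) (s : ℝ) {N : ℕ} (A : Fin N → ℝ) (x : ℝ) : ℝ :=
  ∑ j : Fin N, A j * (cutoffUp (gridPt e s (2 * j)) (gridPt e s (2 * j + 1)) x -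
    cutoffUp (gridPt e s (2 * j + 1)) (gridPt e s (2 * j + 2)) x)

section Grid
variable {e N : ℕ} {s : ℝ} {A : Fin N → ℝ}

theorem gridPt_strictMono (hs : 0 < s) : StrictMono (gridPt e s) := by
  intro i j hij
  have : (i : ℝ) < j := by exact_mod_cast hij
  unfold gridPt
  nlinarith

theorem gridPt_succ_sub (i : ℕ) : gridPt e s (i + 1) - gridPt e s i = s := by
  unfold gridPt; push_cast; ring

theorem node_gridParams (j : ℕ) (hj : j ≤ 2 * N) : node (gridParams e s A) j hj = gridPt e s j := by
  simp only [node, gridParams]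
  rw [dif_pos (by omega)]

theorem amp_gridParams (j : Fin N) : amp (gridParams e s A) j = A j := by
  simp only [amp, gridParams]
  rw [dif_neg (by omega)]
  congr 1
  ext
  simp

theorem gridParams_mem_orderedNodes (hs : 0 < s) : gridParams e s A ∈ orderedNodes N := by
  intro j
  rw [node_gridParams, node_gridParams]
  exact gridPt_strictMono hs (Nat.lt_succ_self _)

theorem smallBumps_gridParams {ε : ℝ} (h : ∀ j, |A j| ≤ ε * s ^ 4) :
    SmallBumps ε (gridParams e s A) := by
  intro j
  simp only [node_gridParams, amp_gridParams, gridPt_succ_sub]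
  exact ⟨h j, trivial⟩

theorem abs_gridParams_lt {ε : ℝ} (he : e ≤ 1) (hs : 0 < s) (hsε : (2 * N + 1) * s < ε)
    (h : ∀ j, |A j| < ε) (i : Fin (3 * N + 1)) : |gridParams e s A i| < ε := by
  unfold gridParams
  split_ifs with hi
  · refine lt_of_le_of_lt ?_ hsε
    rw [gridPt, abs_mul, abs_of_pos hs, mul_comm]
    have h1 : ((i : ℕ) : ℝ) ≤ 2 * N := by exact_mod_cast Nat.lt_succ_iff.1 hi
    have h2 : (e : ℝ) ≤ 1 := by exact_mod_cast he
    have h3 : (0 : ℝ) ≤ e := e.cast_nonneg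
    have h4 : (0 : ℝ) ≤ ((i : ℕ) : ℝ) := Nat.cast_nonneg _
    refine mul_le_mul_of_nonneg_right ?_ hs.le
    rw [abs_le]
    constructor <;> linarith
  · exact h _

theorem psi_gridParams (r₁ r₂ : ℝ) (hN : 0 < N) (hs : 0 < s) :
    psi r₁ r₂ hN (gridParams e s A) = bumpSum e s A := by
  funext x
  rw [psi, if_pos (gridParams_mem_orderedNodes hs), psiStar, bumpSum]
  refine Finset.sum_congr rfl fun j _ => ?_
  rw [amp_gridParams, node_gridParams, node_gridParams, node_gridParams,
    bump_eq (gridPt_strictMono hs (Nat.lt_succ_self _)) (gridPt_strictMono hs (Nat.lt_succ_self _))]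

theorem contDiff_bumpSum (hs : 0 < s) : ContDiff ℝ ∞ (bumpSum e s A) := by
  unfold bumpSum
  refine ContDiff.sum fun j _ => contDiff_const.mul (ContDiff.sub ?_ ?_) <;>
  exact contDiff_cutoffUp (gridPt_strictMono hs (Nat.lt_succ_self _))

theorem differentiable_cutoffUp {a b : ℝ} (hab : a < b) : Differentiable ℝ (cutoffUp a b) :=
  (contDiff_cutoffUp hab).differentiable (by simp)

theorem differentiable_deriv_cutoffUp {a b : ℝ} (hab : a < b) :
    Differentiable ℝ (deriv (cutoffUp a b)) :=
  ((contDiff_succ_iff_deriv (n := 1)).1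
    ((contDiff_cutoffUp hab).of_le (by norm_cast))).2.2.differentiable (by simp)

theorem deriv_bumpSum (hs : 0 < s) : deriv (bumpSum e s A) = fun x =>
    ∑ j : Fin N, A j * (deriv (cutoffUp (gridPt e s (2 * j)) (gridPt e s (2 * j + 1))) x -
      deriv (cutoffUp (gridPt e s (2 * j + 1)) (gridPt e s (2 * j + 2))) x) := by
  funext x
  refine HasDerivAt.deriv ?_
  refine HasDerivAt.fun_sum fun j _ => HasDerivAt.const_mul _ (HasDerivAt.sub ?_ ?_) <;>
  exact (differentiable_cutoffUp (gridPt_strictMono hs (Nat.lt_succ_self _)) x).hasDerivAt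

theorem deriv_deriv_bumpSum (hs : 0 < s) : deriv (deriv (bumpSum e s A)) = fun x =>
    ∑ j : Fin N, A j * (deriv (deriv (cutoffUp (gridPt e s (2 * j)) (gridPt e s (2 * j + 1)))) x -
      deriv (deriv (cutoffUp (gridPt e s (2 * j + 1)) (gridPt e s (2 * j + 2)))) x) := by
  rw [deriv_bumpSum hs]
  funext x
  refine HasDerivAt.deriv ?_
  refine HasDerivAt.fun_sum fun j _ => HasDerivAt.const_mul _ (HasDerivAt.sub ?_ ?_) <;>
  exact (differentiable_deriv_cutoffUp (gridPt_strictMono hs (Nat.lt_succ_self _)) x).hasDerivAt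

theorem abs_sum_amp_mul_sub_le {M B : ℝ} (hM : ∀ j, |A j| ≤ M) {u v : Fin N → ℝ}
    (hu : ∀ j, |u j| ≤ B) (hv : ∀ j, |v j| ≤ B) :
    |∑ j : Fin N, A j * (u j - v j)| ≤ N * (M * (2 * B)) := by
  calc _ ≤ ∑ j : Fin N, |A j * (u j - v j)| := Finset.abs_sum_le_sum_abs _ _
    _ ≤ ∑ _j : Fin N, M * (2 * B) := by
      refine Finset.sum_le_sum fun j _ => ?_
      rw [abs_mul]
      have h1 : |u j - v j| ≤ 2 * B := (abs_sub _ _).trans (by linarith [hu j, hv j])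
      exact mul_le_mul (hM j) h1 (abs_nonneg _) ((abs_nonneg _).trans (hM j))
    _ = _ := by simp

theorem abs_bumpSum_le {M : ℝ} (hM : ∀ j, |A j| ≤ M) (x : ℝ) :
    |bumpSum e s A x| ≤ N * (M * (2 * 1)) :=
  abs_sum_amp_mul_sub_le hM
    (fun _ => by rw [abs_of_nonneg cutoffUp_nonneg]; exact cutoffUp_le_one)
    (fun _ => by rw [abs_of_nonneg cutoffUp_nonneg]; exact cutoffUp_le_one)

theorem abs_deriv_bumpSum_le (hs : 0 < s) (hs1 : s ≤ 1) {M : ℝ} (hM : ∀ j, |A j| ≤ M) (x : ℝ) :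
    |deriv (bumpSum e s A) x| ≤ N * (M * (2 * (2560 / s ^ 4))) := by
  rw [deriv_bumpSum hs]
  have key : ∀ i, |deriv (cutoffUp (gridPt e s i) (gridPt e s (i + 1))) x| ≤ 2560 / s ^ 4 := by
    intro i
    have := abs_deriv_cutoffUp_le (gridPt_strictMono (e := e) hs (Nat.lt_succ_self i))
      (by rw [gridPt_succ_sub]; exact hs1) x
    rwa [gridPt_succ_sub] at this
  exact abs_sum_amp_mul_sub_le hM (fun _ => key _) (fun _ => key _)

theorem abs_deriv_deriv_bumpSum_le (hs : 0 < s) (hs1 : s ≤ 1) {M : ℝ} (hM : ∀ j, |A j| ≤ M)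
    (x : ℝ) : |deriv (deriv (bumpSum e s A)) x| ≤ N * (M * (2 * (2560 / s ^ 4))) := by
  rw [deriv_deriv_bumpSum hs]
  have key : ∀ i, |deriv (deriv (cutoffUp (gridPt e s i) (gridPt e s (i + 1)))) x| ≤
      2560 / s ^ 4 := by
    intro i
    have := abs_deriv_deriv_cutoffUp_le (gridPt_strictMono (e := e) hs (Nat.lt_succ_self i))
      (by rw [gridPt_succ_sub]; exact hs1) x
    rwa [gridPt_succ_sub] at this
  exact abs_sum_amp_mul_sub_le hM (fun _ => key _) (fun _ => key _)

theorem bumpSum_gridPt (hs : 0 < s) (j : Fin N) : bumpSum e s A (gridPt e s (2 * j + 1)) = A j := by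
  have hm := gridPt_strictMono (e := e) hs
  unfold bumpSum
  rw [Finset.sum_eq_single j]
  · rw [cutoffUp_of_ge (hm (Nat.lt_succ_self _)) le_rfl, cutoffUp_of_le le_rfl]; ring
  · intro i _ hij
    have hij' : (i : ℕ) ≠ j := fun h => hij (Fin.ext h)
    rcases lt_or_gt_of_ne hij' with h | h
    · rw [cutoffUp_of_ge (hm (Nat.lt_succ_self _)) (hm.monotone (by omega)),
        cutoffUp_of_ge (hm (Nat.lt_succ_self _)) (hm.monotone (by omega))]; ring
    · rw [cutoffUp_of_le (hm.monotone (by omega)), cutoffUp_of_le (hm.monotone (by omega))]; ring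
  · simp

theorem deriv_bumpSum_gridPt (hs : 0 < s) (i : ℕ) :
    deriv (bumpSum e s A) (gridPt e s i) = 0 := by
  have hm := gridPt_strictMono (e := e) hs
  have key : ∀ j, deriv (cutoffUp (gridPt e s j) (gridPt e s (j + 1))) (gridPt e s i) = 0 := by
    intro j
    refine deriv_cutoffUp_of_notMem (hm (Nat.lt_succ_self _)) fun h => ?_
    have h1 := hm.lt_iff_lt.1 h.1
    have h2 := hm.lt_iff_lt.1 h.2
    omega
  rw [deriv_bumpSum hs]
  refine Finset.sum_eq_zero fun j _ => ?_
  rw [key, key]; ring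

/-- `S` stands for a quantity that is nonpositive on the rising and nonnegative on the falling side of
each bump. -/
theorem mul_deriv_bumpSum_nonpos (hs : 0 < s) (hA : ∀ j, 0 ≤ A j) {x S : ℝ}
    (hl : ∀ j : Fin N, x ∈ Ioo (gridPt e s (2 * j)) (gridPt e s (2 * j + 1)) → S ≤ 0)
    (hr : ∀ j : Fin N, x ∈ Ioo (gridPt e s (2 * j + 1)) (gridPt e s (2 * j + 2)) → 0 ≤ S) :
    S * deriv (bumpSum e s A) x ≤ 0 := by
  have hm := gridPt_strictMono (e := e) hs
  rw [deriv_bumpSum hs, Finset.mul_sum]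
  refine Finset.sum_nonpos fun j _ => ?_
  have h1 : S * deriv (cutoffUp (gridPt e s (2 * j)) (gridPt e s (2 * j + 1))) x ≤ 0 := by
    by_cases hx : x ∈ Ioo (gridPt e s (2 * j)) (gridPt e s (2 * j + 1))
    · exact mul_nonpos_of_nonpos_of_nonneg (hl j hx)
        (deriv_cutoffUp_nonneg (hm (Nat.lt_succ_self _)))
    · rw [deriv_cutoffUp_of_notMem (hm (Nat.lt_succ_self _)) hx, mul_zero]
  have h2 : 0 ≤ S * deriv (cutoffUp (gridPt e s (2 * j + 1)) (gridPt e s (2 * j + 2))) x := by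
    by_cases hx : x ∈ Ioo (gridPt e s (2 * j + 1)) (gridPt e s (2 * j + 2))
    · exact mul_nonneg (hr j hx) (deriv_cutoffUp_nonneg (hm (Nat.lt_succ_self _)))
    · rw [deriv_cutoffUp_of_notMem (hm (Nat.lt_succ_self _)) hx, mul_zero]
  nlinarith [hA j]

end Grid

/-! ### The sign of the polynomial with equidistant roots -/

section Sign
variable {m n e : ℕ} {s x : ℝ}

/-- Exactly the factors with `i ≥ n` are negative. -/
theorem sign_prod_pos (hnm : n ≤ m) (hl : ∀ i < n, s * i < x) (hr : ∀ i, n ≤ i → x < s * i) :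
    0 < (-1) ^ (m + n) * ∏ i : Fin m, (x - s * (i : ℕ)) := by
  rw [Fin.prod_univ_eq_prod_range (fun i : ℕ => x - s * i) m, ← Finset.prod_range_mul_prod_Ico _ hnm]
  have h1 : 0 < ∏ i ∈ Finset.range n, (x - s * (i : ℕ)) :=
    Finset.prod_pos fun i hi => by linarith [hl i (Finset.mem_range.1 hi)]
  have h2 : 0 < (-1) ^ (m + n) * ∏ i ∈ Finset.Ico n m, (x - s * (i : ℕ)) := by
    have e1 : ∏ i ∈ Finset.Ico n m, (x - s * (i : ℕ)) =
        (-1) ^ (m - n) * ∏ i ∈ Finset.Ico n m, (s * (i : ℕ) - x) := by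
      rw [show m - n = (Finset.Ico n m).card by simp, ← Finset.prod_const, ← Finset.prod_mul_distrib]
      exact Finset.prod_congr rfl fun i _ => by ring
    rw [e1, ← mul_assoc, ← pow_add, show m + n + (m - n) = 2 * m by omega, pow_mul]
    simp only [even_two, Even.neg_pow, one_pow, one_mul]
    exact Finset.prod_pos fun i hi => by linarith [hr i (Finset.mem_Ico.1 hi).1]
  nlinarith [mul_pos h1 h2]

theorem sign_prod_of_odd (hnm : n ≤ m) (hl : ∀ i < n, s * i < x) (hr : ∀ i, n ≤ i → x < s * i)
    (h : Odd (n + e)) : 0 < (-1) ^ (m + e + 1) * ∏ i : Fin m, (x - s * (i : ℕ)) := by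
  have := sign_prod_pos hnm hl hr
  have hp : (-1 : ℝ) ^ (m + e + 1) = (-1) ^ (m + n) := by
    rw [neg_one_pow_congr]
    obtain ⟨k, hk⟩ := h
    grind
  rwa [hp]

theorem sign_prod_of_even (hnm : n ≤ m) (hl : ∀ i < n, s * i < x) (hr : ∀ i, n ≤ i → x < s * i)
    (h : Even (n + e)) : (-1) ^ (m + e + 1) * ∏ i : Fin m, (x - s * (i : ℕ)) < 0 := by
  have := sign_prod_pos hnm hl hr
  have hp : (-1 : ℝ) ^ (m + e + 1) = -(-1) ^ (m + n) := by
    rw [pow_succ, neg_one_pow_congr (n := m + n)]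
    · ring
    · obtain ⟨k, hk⟩ := h
      grind
  rw [hp]
  linarith

end Sign

/-! ### Closeness of the unfolded field to the original one -/

section Closeness
variable {f φ : ℝ × ℝ → ℝ} {m : ℕ} {ψ : ℝ → ℝ}

/-- The partial derivative with respect to the first variable. -/
def partialFst (f : ℝ × ℝ → ℝ) (p : ℝ × ℝ) : ℝ := fderiv ℝ f p (1, 0)

/-- The partial derivative with respect to the second variable. -/
def partialSnd (f : ℝ × ℝ → ℝ) (p : ℝ × ℝ) : ℝ := fderiv ℝ f p (0, 1)

theorem continuous_partialFst (hf : ContDiff ℝ ∞ f) : Continuous (partialFst f) :=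
  (hf.continuous_fderiv (by simp)).clm_apply continuous_const

theorem continuous_partialSnd (hf : ContDiff ℝ ∞ f) : Continuous (partialSnd f) :=
  (hf.continuous_fderiv (by simp)).clm_apply continuous_const

theorem hasDerivAt_comp_shift (hf : ContDiff ℝ ∞ f) {ψ' x : ℝ} (hψ : HasDerivAt ψ ψ' x) (y : ℝ) :
    HasDerivAt (fun x => f (x, y + ψ x))
      (partialFst f (x, y + ψ x) + partialSnd f (x, y + ψ x) * ψ') x := by
  have h1 : HasDerivAt (fun x => (x, y + ψ x)) ((1 : ℝ), ψ') x :=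
    (hasDerivAt_id x).prodMk (hψ.const_add y)
  have h2 := ((hf.differentiable (by simp)) (x, y + ψ x)).hasFDerivAt.comp_hasDerivAt x h1
  have e : fderiv ℝ f (x, y + ψ x) (1, ψ') =
      partialFst f (x, y + ψ x) + partialSnd f (x, y + ψ x) * ψ' := by
    rw [show ((1 : ℝ), ψ') = (1, 0) + ψ' • ((0 : ℝ), (1 : ℝ)) by simp, map_add, map_smul]
    simp [partialFst, partialSnd, mul_comm]
  rw [← e]
  exact h2

theorem hasDerivAt_comp_snd (hf : ContDiff ℝ ∞ f) (x y a : ℝ) :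
    HasDerivAt (fun y => f (x, y + a)) (partialSnd f (x, y + a)) y := by
  have h1 : HasDerivAt (fun y : ℝ => (x, y + a)) ((0 : ℝ), (1 : ℝ)) y :=
    (hasDerivAt_const y x).prodMk ((hasDerivAt_id y).add_const a)
  exact ((hf.differentiable (by simp)) (x, y + a)).hasFDerivAt.comp_hasDerivAt y h1

theorem hasDerivAt_prod_sub (lam : Fin m → ℝ) (x : ℝ) :
    HasDerivAt (fun x => ∏ i, (x - lam i)) (∑ i, ∏ j ∈ Finset.univ.erase i, (x - lam j)) x := by
  have := HasDerivAt.fun_finsetProd (u := Finset.univ) (f := fun i (x : ℝ) => x - lam i)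
    (f' := fun _ => 1) (x := x) fun i _ => (hasDerivAt_id x).sub_const _
  simpa using this

/-- The values at a point of `ψ`, `ψ'` and `ψ''`, together with the roots `λ`: the quantities on
which the unfolded field and its first partial derivatives depend continuously. -/
abbrev Jet (m : ℕ) : Type := ℝ × ℝ × ℝ × (Fin m → ℝ)

/-- Uniformity over the compact set `K` comes from the tube lemma. -/
theorem exists_jet_close {K : Set (ℝ × ℝ)} (hK : IsCompact K) {G₁ G₂ G₃ : (ℝ × ℝ) × Jet m → ℝ}
    (h₁ : Continuous G₁) (h₂ : Continuous G₂) (h₃ : Continuous G₃) {ε : ℝ} (hε : 0 < ε) :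
    ∃ δ > 0, ∀ θ : Jet m, ‖θ‖ < δ → ∀ p ∈ K, |G₁ (p, θ) - G₁ (p, 0)| +
      |G₂ (p, θ) - G₂ (p, 0)| + |G₃ (p, θ) - G₃ (p, 0)| < ε := by
  have key : ∀ᶠ θ in 𝓝 (0 : Jet m), ∀ p ∈ K, |G₁ (p, θ) - G₁ (p, 0)| +
      |G₂ (p, θ) - G₂ (p, 0)| + |G₃ (p, θ) - G₃ (p, 0)| < ε := by
    refine hK.eventually_forall_of_forall_eventually fun p _ => ?_
    have hc : Continuous fun z : Jet m × (ℝ × ℝ) => |G₁ (z.2, z.1) - G₁ (z.2, 0)| +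
        |G₂ (z.2, z.1) - G₂ (z.2, 0)| + |G₃ (z.2, z.1) - G₃ (z.2, 0)| := by fun_prop
    refine hc.continuousAt.eventually (gt_mem_nhds ?_)
    simpa using hε
  obtain ⟨δ, hδ, h⟩ := Metric.eventually_nhds_iff.1 key
  exact ⟨δ, hδ, fun θ hθ => h (by simpa using hθ)⟩

theorem upperField_eq_unfoldedField : upperField f φ m = unfoldedField f φ (0 : Fin m → ℝ) 0 := by
  funext p
  simp [upperField, unfoldedField]

theorem exists_c1Close_fst (hf : ContDiff ℝ ∞ f) {U : Set (ℝ × ℝ)} (hU : Bornology.IsBounded U)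
    (m : ℕ) {ε : ℝ} (hε : 0 < ε) :
    ∃ δ > 0, ∀ (lam : Fin m → ℝ) (ψ : ℝ → ℝ), Differentiable ℝ ψ → Differentiable ℝ (deriv ψ) →
      (∀ x, ‖((ψ x, deriv ψ x, deriv (deriv ψ) x, lam) : Jet m)‖ < δ) →
      C1Close ε U (fun p => (unfoldedField f φ lam ψ p).1) (fun p => (upperField f φ m p).1) := by
  have cf := hf.continuous
  have cfx := continuous_partialFst hf
  have cfy := continuous_partialSnd hf
  obtain ⟨δ, hδ, h⟩ := exists_jet_close (m := m) hU.isCompact_closure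
    (G₁ := fun z => f (z.1.1, z.1.2 + z.2.1))
    (G₂ := fun z => partialFst f (z.1.1, z.1.2 + z.2.1) +
      partialSnd f (z.1.1, z.1.2 + z.2.1) * z.2.2.1)
    (G₃ := fun z => partialSnd f (z.1.1, z.1.2 + z.2.1))
    (by fun_prop) (by fun_prop) (by fun_prop) hε
  refine ⟨δ, hδ, fun lam ψ hψ _ hθ p hp => ?_⟩
  have := h _ (hθ p.1) p hp
  have e1 := ((hasDerivAt_comp_shift hf (hψ p.1).hasDerivAt p.2).sub
    (hasDerivAt_comp_shift hf (hasDerivAt_const p.1 (0 : ℝ)) p.2)).deriv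
  have e2 := ((hasDerivAt_comp_snd hf p.1 p.2 (ψ p.1)).sub
    (hasDerivAt_comp_snd hf p.1 p.2 0)).deriv
  rw [upperField_eq_unfoldedField]
  simp only [unfoldedField, Pi.zero_apply]
  erw [e1, e2]
  simpa using this

theorem exists_c1Close_snd (hf : ContDiff ℝ ∞ f) (hφ : ContDiff ℝ ∞ φ) {U : Set (ℝ × ℝ)}
    (hU : Bornology.IsBounded U) (m : ℕ) {ε : ℝ} (hε : 0 < ε) :
    ∃ δ > 0, ∀ (lam : Fin m → ℝ) (ψ : ℝ → ℝ), Differentiable ℝ ψ → Differentiable ℝ (deriv ψ) →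
      (∀ x, ‖((ψ x, deriv ψ x, deriv (deriv ψ) x, lam) : Jet m)‖ < δ) →
      C1Close ε U (fun p => (unfoldedField f φ lam ψ p).2) (fun p => (upperField f φ m p).2) := by
  have cf := hf.continuous
  have cfx := continuous_partialFst hf
  have cfy := continuous_partialSnd hf
  have cφ := hφ.continuous
  have cφx := continuous_partialFst hφ
  have cφy := continuous_partialSnd hφ
  have hx : ∀ (lam : Fin m → ℝ) (ψ : ℝ → ℝ), Differentiable ℝ ψ → Differentiable ℝ (deriv ψ) →
      ∀ p : ℝ × ℝ, HasDerivAt (fun x => φ (x, p.2 + ψ x) * ∏ i, (x - lam i) -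
        f (x, p.2 + ψ x) * deriv ψ x)
      ((partialFst φ (p.1, p.2 + ψ p.1) + partialSnd φ (p.1, p.2 + ψ p.1) * deriv ψ p.1) *
          ∏ i, (p.1 - lam i) + φ (p.1, p.2 + ψ p.1) *
          ∑ i, ∏ j ∈ Finset.univ.erase i, (p.1 - lam j) -
        ((partialFst f (p.1, p.2 + ψ p.1) + partialSnd f (p.1, p.2 + ψ p.1) * deriv ψ p.1) *
          deriv ψ p.1 + f (p.1, p.2 + ψ p.1) * deriv (deriv ψ) p.1)) p.1 := by
    intro lam ψ h1 h2 p
    exact ((hasDerivAt_comp_shift hφ (h1 p.1).hasDerivAt p.2).mul (hasDerivAt_prod_sub lam p.1)).sub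
      ((hasDerivAt_comp_shift hf (h1 p.1).hasDerivAt p.2).mul (h2 p.1).hasDerivAt)
  have hy : ∀ (lam : Fin m → ℝ) (ψ : ℝ → ℝ) (p : ℝ × ℝ),
      HasDerivAt (fun y => φ (p.1, y + ψ p.1) * ∏ i, (p.1 - lam i) -
        f (p.1, y + ψ p.1) * deriv ψ p.1)
      (partialSnd φ (p.1, p.2 + ψ p.1) * ∏ i, (p.1 - lam i) -
        partialSnd f (p.1, p.2 + ψ p.1) * deriv ψ p.1) p.2 := by
    intro lam ψ p
    exact ((hasDerivAt_comp_snd hφ p.1 p.2 (ψ p.1)).mul_const _).sub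
      ((hasDerivAt_comp_snd hf p.1 p.2 (ψ p.1)).mul_const _)
  obtain ⟨δ, hδ, h⟩ := exists_jet_close (m := m) hU.isCompact_closure
    (G₁ := fun z => φ (z.1.1, z.1.2 + z.2.1) * ∏ i, (z.1.1 - z.2.2.2.2 i) -
      f (z.1.1, z.1.2 + z.2.1) * z.2.2.1)
    (G₂ := fun z =>
      (partialFst φ (z.1.1, z.1.2 + z.2.1) + partialSnd φ (z.1.1, z.1.2 + z.2.1) * z.2.2.1) *
          ∏ i, (z.1.1 - z.2.2.2.2 i) + φ (z.1.1, z.1.2 + z.2.1) *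
          ∑ i, ∏ j ∈ Finset.univ.erase i, (z.1.1 - z.2.2.2.2 j) -
        ((partialFst f (z.1.1, z.1.2 + z.2.1) + partialSnd f (z.1.1, z.1.2 + z.2.1) * z.2.2.1) *
          z.2.2.1 + f (z.1.1, z.1.2 + z.2.1) * z.2.2.2.1))
    (G₃ := fun z => partialSnd φ (z.1.1, z.1.2 + z.2.1) * ∏ i, (z.1.1 - z.2.2.2.2 i) -
        partialSnd f (z.1.1, z.1.2 + z.2.1) * z.2.2.1)
    (by fun_prop) (by fun_prop) (by fun_prop) hε
  refine ⟨δ, hδ, fun lam ψ hψ hψ' hθ p hp => ?_⟩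
  have := h _ (hθ p.1) p hp
  have d0 : deriv (fun _ : ℝ => (0 : ℝ)) = fun _ => 0 := by funext; simp
  have e1 := ((hx lam ψ hψ hψ' p).sub (hx 0 0 (differentiable_const (0 : ℝ))
    (by rw [show (0 : ℝ → ℝ) = fun _ => 0 from rfl, d0]; exact differentiable_const _) p)).deriv
  have e2 := ((hy lam ψ p).sub (hy 0 0 p)).deriv
  have d0' : deriv (0 : ℝ → ℝ) = 0 := by
    rw [show (0 : ℝ → ℝ) = fun _ => 0 from rfl, d0]
  rw [upperField_eq_unfoldedField]
  simp only [unfoldedField]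
  erw [e1, e2]
  simpa [d0'] using this

end Closeness

/-! ### The straightened field and its orbits near the origin -/

/-- The unfolded field in the coordinates `(x, y + ψ x)`, in which it does not depend on `ψ`. -/
def straightField (f φ : ℝ × ℝ → ℝ) {m : ℕ} (lam : Fin m → ℝ) (p : ℝ × ℝ) : ℝ × ℝ :=
  (f p, φ p * ∏ i, (p.1 - lam i))

/-- The equidistant roots `0, s, …, (m - 1) s`. -/
def gridRoots (m : ℕ) (s : ℝ) (i : Fin m) : ℝ := s * (i : ℕ)

section Straight
variable {f φ : ℝ × ℝ → ℝ} {m : ℕ} {lam : Fin m → ℝ} {ψ : ℝ → ℝ} {γ : ℝ → ℝ × ℝ} {I : Set ℝ}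

theorem contDiff_straightField (hf : ContDiff ℝ ∞ f) (hφ : ContDiff ℝ ∞ φ) :
    ContDiff ℝ 1 (straightField f φ lam) := by
  have hf' : ContDiff ℝ 1 f := hf.of_le (by norm_cast)
  have hφ' : ContDiff ℝ 1 φ := hφ.of_le (by norm_cast)
  exact hf'.prodMk (hφ'.mul (contDiff_prod fun i _ => contDiff_fst.sub contDiff_const))

theorem contDiff_unfoldedField (hf : ContDiff ℝ ∞ f) (hφ : ContDiff ℝ ∞ φ) (hψ : ContDiff ℝ ∞ ψ) :
    ContDiff ℝ 1 (unfoldedField f φ lam ψ) := by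
  have hf' : ContDiff ℝ 1 f := hf.of_le (by norm_cast)
  have hφ' : ContDiff ℝ 1 φ := hφ.of_le (by norm_cast)
  have hψ' : ContDiff ℝ 1 ψ := hψ.of_le (by norm_cast)
  have hd : ContDiff ℝ 1 (deriv ψ) :=
    ((contDiff_succ_iff_deriv (n := 1)).1 (hψ.of_le (by norm_cast))).2.2
  have hsh : ContDiff ℝ 1 fun p : ℝ × ℝ => (p.1, p.2 + ψ p.1) :=
    contDiff_fst.prodMk (contDiff_snd.add (hψ'.comp contDiff_fst))
  exact (hf'.comp hsh).prodMk (((hφ'.comp hsh).mul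
    (contDiff_prod fun i _ => contDiff_fst.sub contDiff_const)).sub
    ((hf'.comp hsh).mul (hd.comp contDiff_fst)))

theorem IsSolutionOn.straighten (hψ : Differentiable ℝ ψ)
    (h : IsSolutionOn (unfoldedField f φ lam ψ) γ I) :
    IsSolutionOn (straightField f φ lam) (fun t => ((γ t).1, (γ t).2 + ψ (γ t).1)) I := by
  intro t ht
  have h1 := (ContinuousLinearMap.fst ℝ ℝ ℝ).hasFDerivAt.comp_hasDerivWithinAt t (h t ht)
  have h2 := (ContinuousLinearMap.snd ℝ ℝ ℝ).hasFDerivAt.comp_hasDerivWithinAt t (h t ht)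
  have h3 := (hψ (γ t).1).hasDerivAt.comp_hasDerivWithinAt t h1
  have := h1.prodMk (h2.add h3)
  have e : straightField f φ lam ((γ t).1, (γ t).2 + ψ (γ t).1) =
      ((unfoldedField f φ lam ψ (γ t)).1, (unfoldedField f φ lam ψ (γ t)).2 +
        deriv ψ (γ t).1 * (unfoldedField f φ lam ψ (γ t)).1) := by
    simp only [straightField, unfoldedField, Prod.mk.injEq, true_and]
    ring
  rw [e]
  exact this

theorem IsSolutionOn.unstraighten (hψ : Differentiable ℝ ψ)
    (h : IsSolutionOn (straightField f φ lam) γ I) :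
    IsSolutionOn (unfoldedField f φ lam ψ) (fun t => ((γ t).1, (γ t).2 - ψ (γ t).1)) I := by
  intro t ht
  have h1 := (ContinuousLinearMap.fst ℝ ℝ ℝ).hasFDerivAt.comp_hasDerivWithinAt t (h t ht)
  have h2 := (ContinuousLinearMap.snd ℝ ℝ ℝ).hasFDerivAt.comp_hasDerivWithinAt t (h t ht)
  have h3 := (hψ (γ t).1).hasDerivAt.comp_hasDerivWithinAt t h1
  have := h1.prodMk (h2.sub h3)
  have e : unfoldedField f φ lam ψ ((γ t).1, (γ t).2 - ψ (γ t).1) =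
      ((straightField f φ lam (γ t)).1, (straightField f φ lam (γ t)).2 -
        deriv ψ (γ t).1 * (straightField f φ lam (γ t)).1) := by
    simp only [straightField, unfoldedField, Prod.mk.injEq, sub_add_cancel, true_and, Prod.mk.eta]
    ring
  rw [e]
  exact this

theorem JoinedIn.straighten (hψ : Differentiable ℝ ψ) {D : Set (ℝ × ℝ)} {p q : ℝ × ℝ}
    (h : JoinedIn (unfoldedField f φ lam ψ) D p q) :
    JoinedIn (straightField f φ lam) univ (p.1, p.2 + ψ p.1) (q.1, q.2 + ψ q.1) := by
  obtain ⟨γ, a, b, hab, hγ, -, h⟩ := h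
  refine ⟨_, a, b, hab, hγ.straighten hψ, fun _ _ => mem_univ _, ?_⟩
  rcases h with ⟨rfl, rfl⟩ | ⟨rfl, rfl⟩
  · exact Or.inl ⟨rfl, rfl⟩
  · exact Or.inr ⟨rfl, rfl⟩

end Straight

/-- Bounds for the data in the box `|x|, |y| ≤ ρ` (which is `‖p‖ ≤ ρ` in the sup norm of `ℝ × ℝ`):
there `f` is at least `c > 0`, and `φ - g f`
vanishes to first order at the origin. -/
structure BoxBounds (f φ : ℝ × ℝ → ℝ) (U : Set (ℝ × ℝ)) (ρ c M g : ℝ) : Prop where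
  pos : 0 < ρ
  le_one : ρ ≤ 1
  c_pos : 0 < c
  one_le : 1 ≤ M
  mem : ∀ p : ℝ × ℝ, ‖p‖ ≤ 2 * ρ → p ∈ U
  le_f : ∀ p : ℝ × ℝ, ‖p‖ ≤ ρ → c ≤ f p
  f_le : ∀ p : ℝ × ℝ, ‖p‖ ≤ ρ → f p ≤ M
  φ_le : ∀ p : ℝ × ℝ, ‖p‖ ≤ ρ → |φ p| ≤ M
  φ_pos : ∀ p : ℝ × ℝ, ‖p‖ ≤ ρ → 0 < φ p * φ (0, 0)
  defect : ∀ p : ℝ × ℝ, ‖p‖ ≤ ρ → |φ p - g * f p| ≤ M * ‖p‖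

theorem exists_boxBounds {f φ : ℝ × ℝ → ℝ} {U : Set (ℝ × ℝ)} (hf : ContDiff ℝ ∞ f)
    (hφ : ContDiff ℝ ∞ φ) (hU : IsOpen U) (hU0 : ((0, 0) : ℝ × ℝ) ∈ U) (hf0 : 0 < f (0, 0))
    (hφ0 : φ (0, 0) ≠ 0) : ∃ ρ c M g, BoxBounds f φ U ρ c M g := by
  set g := φ (0, 0) / f (0, 0) with hg
  have hd : ContDiff ℝ 1 fun p => φ p - g * f p :=
    (hφ.sub (contDiff_const.mul hf)).of_le (by norm_cast)
  obtain ⟨K, W, hW, hK⟩ := hd.locallyLipschitz (0, 0)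
  have h0 : 0 < φ (0, 0) * φ (0, 0) := mul_self_pos.2 hφ0
  have hcf := hf.continuous
  have hcφ := hφ.continuous
  have ev : ∀ᶠ p in 𝓝 ((0, 0) : ℝ × ℝ), p ∈ U ∧ p ∈ W ∧ f (0, 0) / 2 < f p ∧ f p < f (0, 0) + 1 ∧
      |φ p| < |φ (0, 0)| + 1 ∧ 0 < φ p * φ (0, 0) := by
    have evU : ∀ᶠ p in 𝓝 ((0, 0) : ℝ × ℝ), p ∈ U := hU.mem_nhds hU0
    have evW : ∀ᶠ p in 𝓝 ((0, 0) : ℝ × ℝ), p ∈ W := hW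
    refine evU.and (evW.and (.and ?_ (.and ?_ (.and ?_ ?_))))
    · exact hcf.continuousAt.eventually (lt_mem_nhds (by linarith))
    · exact hcf.continuousAt.eventually (gt_mem_nhds (by linarith))
    · exact hcφ.abs.continuousAt.eventually (gt_mem_nhds (by linarith))
    · exact (hcφ.mul continuous_const).continuousAt.eventually (lt_mem_nhds h0)
  obtain ⟨δ, hδ, h⟩ := Metric.eventually_nhds_iff.1 ev
  have hdist : ∀ p : ℝ × ℝ, dist p (0, 0) = ‖p‖ := fun p => by
    rw [show ((0, 0) : ℝ × ℝ) = 0 from rfl, dist_zero_right]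
  have h' : ∀ p : ℝ × ℝ, ‖p‖ ≤ min (δ / 4) 1 → _ := fun p hp =>
    h (y := p) (by rw [hdist]; linarith [min_le_left (δ / 4) 1])
  have hKn : (0 : ℝ) ≤ K := K.2
  have hφn := abs_nonneg (φ (0, 0))
  refine ⟨min (δ / 4) 1, f (0, 0) / 2, f (0, 0) + |φ (0, 0)| + 1 + K, g, ?_⟩
  refine ⟨lt_min (by linarith) one_pos, min_le_right _ _, by linarith, by linarith,
    fun p hp => (h (y := p) (by rw [hdist]; linarith [min_le_left (δ / 4) 1])).1,
    fun p hp => (h' p hp).2.2.1.le, fun p hp => ?_, fun p hp => ?_,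
    fun p hp => (h' p hp).2.2.2.2.2, fun p hp => ?_⟩
  · linarith [(h' p hp).2.2.2.1]
  · linarith [(h' p hp).2.2.2.2.1]
  · have := hK.dist_le_mul p (h' p hp).2.1 (0, 0) (mem_of_mem_nhds hW)
    rw [show ((0, 0) : ℝ × ℝ) = 0 from rfl, dist_zero_right, Real.dist_eq] at this
    have e0 : φ 0 - g * f 0 = 0 := by
      have hf0' : f 0 ≠ 0 := hf0.ne'
      rw [hg, show ((0, 0) : ℝ × ℝ) = 0 from rfl]
      field_simp
      ring
    rw [e0, sub_zero] at this
    refine this.trans (mul_le_mul_of_nonneg_right (by linarith) (norm_nonneg _))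

section Orbit
variable {f φ : ℝ × ℝ → ℝ} {U : Set (ℝ × ℝ)} {ρ c M g : ℝ} {m e : ℕ}

theorem prod_abs_le {s R x : ℝ} (hx : ∀ i < m, |x - s * (i : ℕ)| ≤ R) :
    |∏ i : Fin m, (x - gridRoots m s i)| ≤ R ^ m := by
  rw [Finset.abs_prod]
  calc _ ≤ ∏ _i : Fin m, R :=
        Finset.prod_le_prod (fun _ _ => abs_nonneg _) fun i _ => hx i i.isLt
    _ = R ^ m := by simp

/-- Along the orbit of the straightened field that starts over the first visible root, all visible
roots are reached at heights that differ from the initial one by at most `K s ^ 5`. For `m ≥ 4` this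
is the size of the whole vertical motion. For `m = 3` it holds because
`x (x - s) (x - 2 s)` is the derivative of `x ^ 2 (x - 2 s) ^ 2 / 4`, which vanishes at both visible
roots; the remaining error is due to the variation of `φ / f`. For `m ≤ 2` there is only one visible
root. -/
theorem exists_group_orbit (hB : BoxBounds f φ U ρ c M g) (hf : ContDiff ℝ ∞ f)
    (hφ : ContDiff ℝ ∞ φ) (he : e ≤ 1) (hem : e < m) :
    ∃ K > 0, ∃ s₀ > 0, ∀ s > 0, s ≤ s₀ → ∀ h : ℝ, |h| ≤ s →
      ∃ (γ : ℝ → ℝ × ℝ) (T : ℝ), 0 ≤ T ∧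
        IsSolutionOn (straightField f φ (gridRoots m s)) γ (Icc 0 T) ∧ γ 0 = (e * s, h) ∧
        (∀ t ∈ Icc 0 T, ‖γ t‖ ≤ ρ) ∧
        ∀ j < (m + 1 - e) / 2, ∃ t ∈ Icc 0 T,
          (γ t).1 = s * (2 * j + e) ∧ |(γ t).2 - h| ≤ K * s ^ 5 := by
  have hc := hB.c_pos
  have hM := hB.one_le
  have hm0 : 0 < m := by omega
  have hmR : (1 : ℝ) ≤ m := by exact_mod_cast hm0
  have he' : (e : ℝ) ≤ 1 := by exact_mod_cast he
  have he0 : (0 : ℝ) ≤ e := e.cast_nonneg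
  set b : ℝ := m * M / c with hb
  have hb0 : 0 < b := by positivity
  set R : ℝ := b + 1 + m with hR
  have hR1 : 1 ≤ R := by linarith
  refine ⟨M * R ^ 4 * (m / c), by positivity, ρ / R, by have := hB.pos; positivity, ?_⟩
  intro s hs hss h hh
  have hRs : R * s ≤ ρ := by rw [le_div_iff₀ (by linarith)] at hss; linarith
  have hRs1 : R * s ≤ 1 := hRs.trans hB.le_one
  have hs1 : s ≤ 1 := by nlinarith
  have hRs0 : 0 ≤ R * s := by positivity
  -- The ball of radius `b s` around the initial point lies in the box.
  have hball : ∀ q ∈ closedBall ((e * s, h) : ℝ × ℝ) (b * s), ‖q‖ ≤ (b + 1) * s := by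
    intro q hq
    have h1 : ‖q‖ ≤ dist q (e * s, h) + ‖((e * s, h) : ℝ × ℝ)‖ := by
      rw [dist_eq_norm]; exact norm_le_norm_sub_add _ _
    have h2 : ‖((e * s, h) : ℝ × ℝ)‖ ≤ s := by
      rw [Prod.norm_mk]
      refine max_le ?_ hh
      rw [Real.norm_of_nonneg (by positivity)]
      nlinarith
    have := mem_closedBall.1 hq
    linarith
  have hbox : ∀ q ∈ closedBall ((e * s, h) : ℝ × ℝ) (b * s), ‖q‖ ≤ R * s := fun q hq =>
    (hball q hq).trans (by nlinarith)
  have hP : ∀ q ∈ closedBall ((e * s, h) : ℝ × ℝ) (b * s),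
      |∏ i : Fin m, (q.1 - gridRoots m s i)| ≤ (R * s) ^ m := by
    intro q hq
    refine prod_abs_le fun i hi => ?_
    have h1 : |q.1| ≤ (b + 1) * s := (norm_fst_le q).trans (hball q hq)
    have h2 : (i : ℝ) ≤ m := by exact_mod_cast hi.le
    have h3 : |s * (i : ℝ)| ≤ s * m := by
      rw [abs_of_nonneg (by positivity)]; gcongr
    calc |q.1 - s * (i : ℝ)| ≤ |q.1| + |s * (i : ℝ)| := abs_sub _ _
      _ ≤ (b + 1) * s + s * m := add_le_add h1 h3
      _ = R * s := by rw [hR]; ring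
  have hV : ∀ q ∈ closedBall ((e * s, h) : ℝ × ℝ) (b * s),
      ‖straightField f φ (gridRoots m s) q‖ ≤ M := by
    intro q hq
    have hq' := (hbox q hq).trans hRs
    rw [straightField, Prod.norm_mk]
    refine max_le ?_ ?_
    · rw [Real.norm_of_nonneg (hc.le.trans (hB.le_f q hq'))]; exact hB.f_le q hq'
    · rw [norm_mul]
      calc ‖φ q‖ * ‖∏ i : Fin m, (q.1 - gridRoots m s i)‖ ≤ M * 1 :=
            mul_le_mul (hB.φ_le q hq') ((hP q hq).trans (pow_le_one₀ hRs0 hRs1))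
              (norm_nonneg _) (by linarith)
        _ = M := mul_one M
  obtain ⟨γ, hγ, h0, hmem⟩ := exists_solution_mem_closedBall (p := (e * s, h)) (a := b * s) (L := M)
    (T := m * s / c) (contDiff_straightField (lam := gridRoots m s) hf hφ) (by positivity)
    (by linarith) (by positivity) hV (by rw [hb]; apply le_of_eq; ring)
  set T : ℝ := m * s / c with hT
  have hT0 : 0 ≤ T := by positivity
  refine ⟨γ, T, hT0, hγ, h0, fun t ht => (hbox _ (hmem t ht)).trans hRs, ?_⟩
  have d1 : ∀ t ∈ Icc 0 T, HasDerivWithinAt (fun t => (γ t).1) (f (γ t)) (Icc 0 T) t := fun t ht =>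
    (ContinuousLinearMap.fst ℝ ℝ ℝ).hasFDerivAt.comp_hasDerivWithinAt t (hγ t ht)
  have d2 : ∀ t ∈ Icc 0 T, HasDerivWithinAt (fun t => (γ t).2)
      (φ (γ t) * ∏ i : Fin m, ((γ t).1 - gridRoots m s i)) (Icc 0 T) t := fun t ht =>
    (ContinuousLinearMap.snd ℝ ℝ ℝ).hasFDerivAt.comp_hasDerivWithinAt t (hγ t ht)
  -- The speed of `x` is at least `c`, so that `x` advances by at least `m s`.
  have hadv : s * m ≤ (γ T).1 - (γ 0).1 := by
    have := (convex_Icc (0 : ℝ) T).mul_sub_le_image_sub_of_le_deriv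
      (f := fun t => (γ t).1) (C := c) (fun t ht => (d1 t ht).continuousWithinAt)
      (fun t ht => by
        rw [interior_Icc] at ht ⊢
        exact ((d1 t ⟨ht.1.le, ht.2.le⟩).differentiableWithinAt).mono Ioo_subset_Icc_self)
      (fun t ht => by
        rw [interior_Icc] at ht
        rw [((d1 t ⟨ht.1.le, ht.2.le⟩).hasDerivAt (Icc_mem_nhds ht.1 ht.2)).deriv]
        exact hB.le_f _ ((hbox _ (hmem t ⟨ht.1.le, ht.2.le⟩)).trans hRs))
      0 ⟨le_rfl, hT0⟩ T ⟨hT0, le_rfl⟩ hT0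
    refine le_trans (le_of_eq ?_) this
    rw [hT]; field_simp; ring
  intro j hj
  rcases Nat.eq_zero_or_pos j with rfl | hj0
  · refine ⟨0, ⟨le_rfl, hT0⟩, ?_, ?_⟩
    · rw [h0]; push_cast; ring
    · rw [h0]; simp only [sub_self, abs_zero]; positivity
  have hjm : 2 * j + e ≤ m - 1 := by omega
  have hjmR : (2 * j + e : ℝ) ≤ m := by exact_mod_cast (by omega : 2 * j + e ≤ m)
  obtain ⟨t, ht, htx⟩ : ∃ t ∈ Icc 0 T, (γ t).1 = s * (2 * j + e) := by
    refine intermediate_value_Icc hT0 (f := fun t => (γ t).1)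
      (fun t ht => (d1 t ht).continuousWithinAt) ⟨?_, ?_⟩
    · rw [h0]; simp only; nlinarith [mul_nonneg hs.le (Nat.cast_nonneg (α := ℝ) j)]
    · rw [h0] at hadv; simp only at hadv ⊢; nlinarith [mul_nonneg he0 hs.le]
  refine ⟨t, ht, htx, ?_⟩
  have fin : M * (R * s) ^ 4 * (t - 0) ≤ M * R ^ 4 * (m / c) * s ^ 5 := by
    have : t - 0 ≤ m * s / c := by linarith [ht.2]
    calc M * (R * s) ^ 4 * (t - 0) ≤ M * (R * s) ^ 4 * (m * s / c) := by gcongr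
      _ = _ := by ring
  rcases Nat.lt_or_ge 3 m with hm4 | hm3
  · have := norm_image_sub_le_of_norm_deriv_le_segment' d2 (C := M * (R * s) ^ 4)
      (fun u hu => by
        have hu' : u ∈ Icc 0 T := ⟨hu.1, hu.2.le⟩
        rw [norm_mul]
        refine mul_le_mul (hB.φ_le _ ((hbox _ (hmem u hu')).trans hRs))
          ((hP _ (hmem u hu')).trans ?_) (norm_nonneg _) (by linarith)
        exact pow_le_pow_of_le_one hRs0 hRs1 hm4) t ht
    rw [h0] at this
    exact this.trans fin
  · obtain rfl : m = 3 := by omega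
    obtain rfl : e = 0 := by omega
    obtain rfl : j = 1 := by omega
    have d3 : ∀ t ∈ Icc 0 T, HasDerivWithinAt
        (fun t => (γ t).2 - g * ((γ t).1 ^ 2 * ((γ t).1 - 2 * s) ^ 2 / 4))
        ((φ (γ t) - g * f (γ t)) * ∏ i : Fin 3, ((γ t).1 - gridRoots 3 s i)) (Icc 0 T) t := by
      intro t ht
      have h1 := d1 t ht
      have h2 := ((h1.fun_pow 2).fun_mul ((h1.sub_const (2 * s)).fun_pow 2)).div_const 4
      have := (d2 t ht).fun_sub (h2.const_mul g)
      refine this.congr_deriv ?_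
      simp only [Fin.prod_univ_three, gridRoots]
      norm_num
      ring
    have := norm_image_sub_le_of_norm_deriv_le_segment' d3 (C := M * (R * s) ^ 4)
      (fun u hu => by
        have hu' : u ∈ Icc 0 T := ⟨hu.1, hu.2.le⟩
        rw [norm_mul]
        calc _ ≤ (M * (R * s)) * (R * s) ^ 3 := by
              refine mul_le_mul ((hB.defect _ ((hbox _ (hmem u hu')).trans hRs)).trans ?_)
                (hP _ (hmem u hu')) (norm_nonneg _) (by positivity)
              exact mul_le_mul_of_nonneg_left (hbox _ (hmem u hu')) (by linarith)
          _ = _ := by ring) t ht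
    rw [h0, htx] at this
    refine le_trans (le_of_eq ?_) (this.trans fin)
    rw [Real.norm_eq_abs]
    congr 1
    push_cast
    ring

end Orbit

/-! ### Tangent points of the unfolded field -/

/-- An unfolding with equidistant roots and nonnegative bump amplitudes that is small enough for the
bounds in the box. The parity `e` is chosen such that the roots `(2 j + e) s`, at which the bumps
are centred, are the visible ones. -/
structure GridConfig (f φ : ℝ × ℝ → ℝ) (U : Set (ℝ × ℝ)) (ρ c M g : ℝ) (m e N : ℕ) (s : ℝ)
    (A : Fin N → ℝ) : Prop where
  box : BoxBounds f φ U ρ c M g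
  smooth_f : ContDiff ℝ ∞ f
  smooth_φ : ContDiff ℝ ∞ φ
  e_le : e ≤ 1
  e_lt : e < m
  sign : 0 < φ (0, 0) * (-1) ^ (m + e + 1)
  N_eq : N = (m + 1 - e) / 2
  s_pos : 0 < s
  A_nonneg : ∀ j, 0 ≤ A j
  bump_lt : ∀ x, |bumpSum e s A x| < ρ
  roots_lt : m * s < ρ

namespace GridConfig
variable {f φ : ℝ × ℝ → ℝ} {U : Set (ℝ × ℝ)} {ρ c M g : ℝ} {m e N : ℕ} {s : ℝ} {A : Fin N → ℝ}

theorem prod_neg (h : GridConfig f φ U ρ c M g m e N s A) {n : ℕ} {x : ℝ} (hnm : n ≤ m)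
    (hl : s * ((n : ℝ) - 1) < x) (hr : x < s * n) (hn : Even (n + e)) :
    (-1) ^ (m + e + 1) * ∏ i, (x - gridRoots m s i) < 0 := by
  have hs := h.s_pos
  refine sign_prod_of_even hnm (fun i hi => ?_) (fun i hi => ?_) hn
  · have : (i : ℝ) + 1 ≤ n := by exact_mod_cast hi
    nlinarith
  · have : (n : ℝ) ≤ i := by exact_mod_cast hi
    nlinarith

theorem prod_pos (h : GridConfig f φ U ρ c M g m e N s A) {n : ℕ} {x : ℝ} (hnm : n ≤ m)
    (hl : s * ((n : ℝ) - 1) < x) (hr : x < s * n) (hn : Odd (n + e)) :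
    0 < (-1) ^ (m + e + 1) * ∏ i, (x - gridRoots m s i) := by
  have hs := h.s_pos
  refine sign_prod_of_odd hnm (fun i hi => ?_) (fun i hi => ?_) hn
  · have : (i : ℝ) + 1 ≤ n := by exact_mod_cast hi
    nlinarith
  · have : (n : ℝ) ≤ i := by exact_mod_cast hi
    nlinarith

theorem two_mul_add_lt (h : GridConfig f φ U ρ c M g m e N s A) {j : ℕ} (hj : j < N) :
    2 * j + e < m := by
  have := h.N_eq
  have := h.e_lt
  omega

/-- The bumps have nonnegative amplitudes and their centres are minima over the roots; hence the
slope of `ψ` never has the sign of the vertical component of the straightened field. -/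
theorem prod_mul_deriv_nonpos (h : GridConfig f φ U ρ c M g m e N s A) (x : ℝ) :
    ((-1) ^ (m + e + 1) * ∏ i, (x - gridRoots m s i)) * deriv (bumpSum e s A) x ≤ 0 := by
  refine mul_deriv_bumpSum_nonpos h.s_pos h.A_nonneg (fun j hx => ?_) (fun j hx => ?_)
  · have hj := h.two_mul_add_lt j.isLt
    simp only [gridPt, mem_Ioo] at hx
    push_cast at hx
    refine (h.prod_neg (n := 2 * j + e) hj.le ?_ ?_ ⟨j + e, by ring⟩).le
    · push_cast; linarith [hx.1]
    · push_cast; linarith [hx.2]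
  · have hj := h.two_mul_add_lt j.isLt
    simp only [gridPt, mem_Ioo] at hx
    push_cast at hx
    refine (h.prod_pos (n := 2 * j + e + 1) hj ?_ ?_ ⟨j + e, by ring⟩).le
    · push_cast; linarith [hx.1]
    · push_cast; linarith [hx.2]

theorem deriv_eq_zero_of_root (h : GridConfig f φ U ρ c M g m e N s A) (n : ℕ) :
    deriv (bumpSum e s A) (s * n) = 0 := by
  have := deriv_bumpSum_gridPt (e := e) (A := A) h.s_pos (n + 1 - e)
  have he := h.e_le
  rwa [gridPt, Nat.cast_sub (by omega), Nat.cast_add, Nat.cast_one,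
    show (n : ℝ) + 1 - e + e - 1 = n by ring] at this

/-- The vertical component, with the sign of `φ` near the origin split off. -/
theorem snd_eq (q : ℝ × ℝ) : (unfoldedField f φ (gridRoots m s) (bumpSum e s A) q).2 =
    (φ (q.1, q.2 + bumpSum e s A q.1) * (-1) ^ (m + e + 1)) *
      ((-1) ^ (m + e + 1) * ∏ i, (q.1 - gridRoots m s i)) -
    f (q.1, q.2 + bumpSum e s A q.1) * deriv (bumpSum e s A) q.1 := by
  have : ((-1 : ℝ) ^ (m + e + 1)) * (-1) ^ (m + e + 1) = 1 := by
    rw [← mul_pow]; simp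
  rw [unfoldedField]
  linear_combination (-φ (q.1, q.2 + bumpSum e s A q.1) * ∏ i, (q.1 - gridRoots m s i)) * this

theorem φ_sign (h : GridConfig f φ U ρ c M g m e N s A) {p : ℝ × ℝ} (hp : ‖p‖ ≤ ρ) :
    0 < φ p * (-1) ^ (m + e + 1) := by
  have h1 := mul_pos (h.box.φ_pos p hp) h.sign
  have h2 : φ p * φ (0, 0) * (φ (0, 0) * (-1) ^ (m + e + 1)) =
      φ (0, 0) ^ 2 * (φ p * (-1) ^ (m + e + 1)) := by ring
  rw [h2] at h1
  exact pos_of_mul_pos_right h1 (sq_nonneg _)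

variable {q : ℝ × ℝ}

theorem snd_pos (h : GridConfig f φ U ρ c M g m e N s A)
    (hq : ‖(q.1, q.2 + bumpSum e s A q.1)‖ ≤ ρ)
    (hS : 0 < (-1) ^ (m + e + 1) * ∏ i, (q.1 - gridRoots m s i)) :
    0 < (unfoldedField f φ (gridRoots m s) (bumpSum e s A) q).2 := by
  have h1 := h.prod_mul_deriv_nonpos q.1
  have h2 : deriv (bumpSum e s A) q.1 ≤ 0 := nonpos_of_mul_nonpos_right h1 hS
  have h3 := mul_pos (h.φ_sign hq) hS
  have h4 := mul_nonpos_of_nonneg_of_nonpos (h.box.c_pos.le.trans (h.box.le_f _ hq)) h2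
  rw [snd_eq]
  linarith

theorem snd_neg (h : GridConfig f φ U ρ c M g m e N s A)
    (hq : ‖(q.1, q.2 + bumpSum e s A q.1)‖ ≤ ρ)
    (hS : (-1) ^ (m + e + 1) * ∏ i, (q.1 - gridRoots m s i) < 0) :
    (unfoldedField f φ (gridRoots m s) (bumpSum e s A) q).2 < 0 := by
  have h1 := h.prod_mul_deriv_nonpos q.1
  have h2 : 0 ≤ deriv (bumpSum e s A) q.1 := nonneg_of_mul_nonpos_right h1 hS
  have h3 := mul_neg_of_pos_of_neg (h.φ_sign hq) hS
  have h4 := mul_nonneg (h.box.c_pos.le.trans (h.box.le_f _ hq)) h2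
  rw [snd_eq]
  linarith

theorem norm_lift_lt (h : GridConfig f φ U ρ c M g m e N s A) {x : ℝ} (hx : |x| < ρ) :
    ‖(x, 0 + bumpSum e s A x)‖ < ρ := by
  rw [Prod.norm_mk, zero_add]
  exact max_lt hx (h.bump_lt x)

theorem contDiff_field (h : GridConfig f φ U ρ c M g m e N s A) :
    ContDiff ℝ 1 (unfoldedField f φ (gridRoots m s) (bumpSum e s A)) :=
  contDiff_unfoldedField h.smooth_f h.smooth_φ (contDiff_bumpSum h.s_pos)

theorem fst_pos (h : GridConfig f φ U ρ c M g m e N s A) {x : ℝ} (hx : |x| < ρ) :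
    0 < (unfoldedField f φ (gridRoots m s) (bumpSum e s A) (x, 0)).1 :=
  h.box.c_pos.trans_le (h.box.le_f _ (h.norm_lift_lt hx).le)

theorem root_mem (h : GridConfig f φ U ρ c M g m e N s A) {n : ℕ} (hn : n < m) :
    |s * (n : ℝ)| < ρ := by
  have hs := h.s_pos
  have : (n : ℝ) ≤ m := by exact_mod_cast hn.le
  rw [abs_of_nonneg (by positivity)]
  nlinarith [h.roots_lt]

theorem exists_root_of_isTangentPoint (h : GridConfig f φ U ρ c M g m e N s A) {x : ℝ}
    (hx : |x| < ρ) (ht : IsTangentPoint (unfoldedField f φ (gridRoots m s) (bumpSum e s A)) x) :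
    ∃ n < m, x = s * (n : ℕ) := by
  have hq := (h.norm_lift_lt hx).le
  rcases lt_trichotomy ((-1) ^ (m + e + 1) * ∏ i, (x - gridRoots m s i)) 0 with h1 | h1 | h1
  · exact absurd ht.1 (h.snd_neg (q := (x, 0)) hq h1).ne
  · rw [mul_eq_zero, Finset.prod_eq_zero_iff] at h1
    rcases h1 with h1 | ⟨i, -, hi⟩
    · exact absurd h1 (pow_ne_zero _ (by norm_num))
    · exact ⟨i, i.isLt, by simpa [gridRoots, sub_eq_zero] using hi⟩
  · exact absurd ht.1 (h.snd_pos (q := (x, 0)) hq h1).ne'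

theorem isTangentPoint_root (h : GridConfig f φ U ρ c M g m e N s A) {n : ℕ} (hn : n < m) :
    IsTangentPoint (unfoldedField f φ (gridRoots m s) (bumpSum e s A)) (s * n) := by
  refine ⟨?_, (h.fst_pos (h.root_mem hn)).ne'⟩
  have hP : ∏ i, (s * (n : ℝ) - gridRoots m s i) = 0 :=
    Finset.prod_eq_zero (Finset.mem_univ (⟨n, hn⟩ : Fin m)) (by simp [gridRoots])
  simp only [unfoldedField, h.deriv_eq_zero_of_root, hP]
  ring

theorem eventually_near_root (h : GridConfig f φ U ρ c M g m e N s A) {n : ℕ} (hn : n < m) :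
    ∀ᶠ q in 𝓝 ((s * n, 0) : ℝ × ℝ), ‖(q.1, q.2 + bumpSum e s A q.1)‖ ≤ ρ ∧
      s * ((n : ℝ) - 1) < q.1 ∧ q.1 < s * (n + 1) := by
  have hs := h.s_pos
  have hc : Continuous fun q : ℝ × ℝ => ‖(q.1, q.2 + bumpSum e s A q.1)‖ := by
    have := (contDiff_bumpSum (e := e) (A := A) hs).continuous
    fun_prop
  have h1 : ∀ᶠ q in 𝓝 ((s * n, 0) : ℝ × ℝ), ‖(q.1, q.2 + bumpSum e s A q.1)‖ < ρ :=
    hc.continuousAt.eventually (gt_mem_nhds (by exact h.norm_lift_lt (h.root_mem hn)))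
  have h2 : ∀ᶠ q in 𝓝 ((s * n, 0) : ℝ × ℝ), s * ((n : ℝ) - 1) < q.1 :=
    continuous_fst.continuousAt.eventually (lt_mem_nhds (by simp only; nlinarith))
  have h3 : ∀ᶠ q in 𝓝 ((s * n, 0) : ℝ × ℝ), q.1 < s * ((n : ℝ) + 1) :=
    continuous_fst.continuousAt.eventually (gt_mem_nhds (by simp only; nlinarith))
  filter_upwards [h1, h2, h3] with q a b c using ⟨a.le, b, c⟩

/-- The sign of the product changes from negative to positive at the roots of even `n + e`, and from
positive to negative at the others. -/
theorem isVisible_root_iff (h : GridConfig f φ U ρ c M g m e N s A) {n : ℕ} (hn : n < m) :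
    IsVisible (unfoldedField f φ (gridRoots m s) (bumpSum e s A)) (s * n) ↔ Even (n + e) := by
  have hev := h.eventually_near_root hn
  have h1 := h.fst_pos (h.root_mem hn)
  constructor
  · intro hv
    by_contra hodd
    refine not_rightSegmentAbove_of_neg h.contDiff_field.continuous h1 ?_ hv.2.2
    filter_upwards [hev] with q hq hx
    refine h.snd_neg hq.1 (h.prod_neg (n := n + 1) hn ?_ ?_ ?_)
    · push_cast; simpa using hx
    · push_cast; exact hq.2.2
    · rw [Nat.not_even_iff_odd] at hodd
      rw [add_right_comm]; exact hodd.add_one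
  · intro he
    refine ⟨h.isTangentPoint_root hn, leftSegmentAbove_of_neg h.contDiff_field h1 ?_,
      rightSegmentAbove_of_pos h.contDiff_field h1 ?_⟩
    · filter_upwards [hev] with q hq hx
      exact h.snd_neg hq.1 (h.prod_neg hn.le hq.2.1 hx he)
    · filter_upwards [hev] with q hq hx
      refine h.snd_pos hq.1 (h.prod_pos (n := n + 1) hn ?_ ?_ ?_)
      · push_cast; simpa using hx
      · push_cast; exact hq.2.2
      · rw [add_right_comm]; exact he.add_one

theorem isVisible_iff (h : GridConfig f φ U ρ c M g m e N s A) {x : ℝ} (hx : |x| < ρ) :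
    IsVisible (unfoldedField f φ (gridRoots m s) (bumpSum e s A)) x ↔
      ∃ j < N, x = s * (2 * (j : ℕ) + e) := by
  have hN := h.N_eq
  have he := h.e_le
  constructor
  · intro hv
    obtain ⟨n, hn, rfl⟩ := h.exists_root_of_isTangentPoint hx hv.1
    obtain ⟨k, hk⟩ := (h.isVisible_root_iff hn).1 hv
    refine ⟨k - e, by omega, ?_⟩
    have : n = 2 * (k - e) + e := by omega
    nth_rw 1 [this]
    push_cast
    ring
  · rintro ⟨j, hj, rfl⟩
    have := (h.isVisible_root_iff (h.two_mul_add_lt hj)).2 ⟨j + e, by ring⟩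
    push_cast at this
    exact this

theorem visible_mem (h : GridConfig f φ U ρ c M g m e N s A) {j : ℕ} (hj : j < N) :
    |s * (2 * (j : ℝ) + e)| < ρ := by
  have := h.root_mem (h.two_mul_add_lt hj)
  push_cast at this
  exact this

theorem visible_mem_upperRegion (h : GridConfig f φ U ρ c M g m e N s A) {j : ℕ} (hj : j < N) :
    ((s * (2 * (j : ℝ) + e), 0) : ℝ × ℝ) ∈ upperRegion U := by
  refine ⟨h.box.mem _ ?_, le_rfl⟩
  rw [Prod.norm_mk, norm_zero]
  have := h.box.pos
  exact max_le (by linarith [h.visible_mem hj, Real.norm_eq_abs (s * (2 * (j : ℝ) + e))])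
    (by linarith)

theorem bumpSum_visible (h : GridConfig f φ U ρ c M g m e N s A) (j : Fin N) :
    bumpSum e s A (s * (2 * (j : ℕ) + e)) = A j := by
  have := bumpSum_gridPt (e := e) (A := A) h.s_pos j
  rw [gridPt] at this
  push_cast at this
  rwa [show (2 * ((j : ℕ) : ℝ) + 1 + e - 1) = 2 * (j : ℕ) + e by ring] at this

/-- If an orbit of the straightened field meets the graph of `ψ` over two consecutive visible roots,
then it stays above the graph in between: its height over the graph first increases and then
decreases. -/
theorem joinedIn_succ (h : GridConfig f φ U ρ c M g m e N s A) {γ : ℝ → ℝ × ℝ} {T : ℝ}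
    (hγ : IsSolutionOn (straightField f φ (gridRoots m s)) γ (Icc 0 T))
    (hbox : ∀ t ∈ Icc 0 T, ‖γ t‖ ≤ ρ) {j : ℕ} (hj : j + 1 < N) {t₁ t₂ : ℝ} (ht₁ : t₁ ∈ Icc 0 T)
    (ht₂ : t₂ ∈ Icc 0 T) (h₁ : (γ t₁).1 = s * (2 * j + e)) (h₂ : (γ t₂).1 = s * (2 * (j + 1) + e))
    (h₁' : (γ t₁).2 = bumpSum e s A (γ t₁).1) (h₂' : (γ t₂).2 = bumpSum e s A (γ t₂).1) :
    JoinedIn (unfoldedField f φ (gridRoots m s) (bumpSum e s A)) (upperRegion U)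
      (s * (2 * j + e), 0) (s * (2 * (j + 1) + e), 0) := by
  have hs := h.s_pos
  have hψ : Differentiable ℝ (bumpSum e s A) := (contDiff_bumpSum hs).differentiable (by simp)
  have hx : ∀ u ∈ Icc 0 T, ∀ v ∈ Icc 0 T, u < v → (γ u).1 < (γ v).1 := by
    intro u hu v hv huv
    refine (hγ.mono (Icc_subset_Icc hu.1 hv.2)).fst_lt huv fun w hw => ?_
    exact h.box.c_pos.trans_le
      (h.box.le_f _ (hbox w ⟨hu.1.trans hw.1.le, hw.2.le.trans hv.2⟩))
  have ht : t₁ < t₂ := by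
    by_contra! hle
    rcases hle.eq_or_lt with rfl | hlt
    · rw [h₁] at h₂; nlinarith
    · have := hx _ ht₂ _ ht₁ hlt
      rw [h₁, h₂] at this
      nlinarith
  have hη := hγ.unstraighten hψ
  set η : ℝ → ℝ × ℝ := fun t => ((γ t).1, (γ t).2 - bumpSum e s A (γ t).1) with hηdef
  have hηbox : ∀ t ∈ Icc 0 T, ‖((η t).1, (η t).2 + bumpSum e s A (η t).1)‖ ≤ ρ := by
    intro t ht
    simpa [hηdef] using hbox t ht
  have e₁ : η t₁ = (s * (2 * j + e), 0) := by
    simp only [hηdef]; rw [h₁', sub_self, h₁]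
  have e₂ : η t₂ = (s * (2 * (j + 1) + e), 0) := by
    simp only [hηdef]; rw [h₂', sub_self, h₂]
  have hjm := h.two_mul_add_lt hj
  have hsub : Icc t₁ t₂ ⊆ Icc 0 T := Icc_subset_Icc ht₁.1 ht₂.2
  refine ⟨η, t₁, t₂, ht.le, hη.mono hsub, fun t htt => ?_, Or.inl ⟨e₁, e₂⟩⟩
  have hmem := hsub htt
  have hy : 0 ≤ (η t).2 := by
    rcases le_total (γ t).1 (s * (2 * j + e + 1)) with hle | hle
    · rcases htt.1.eq_or_lt with rfl | hlt
      · rw [e₁]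
      have := (hη.mono (Icc_subset_Icc ht₁.1 hmem.2)).snd_lt hlt fun u hu => by
        have hu' : u ∈ Icc 0 T := ⟨ht₁.1.trans hu.1.le, hu.2.le.trans hmem.2⟩
        refine h.snd_pos (hηbox u hu') (h.prod_pos (n := 2 * j + e + 1) (by omega) ?_ ?_
          ⟨j + e, by ring⟩)
        · have := hx _ ht₁ _ hu' hu.1
          rw [h₁] at this
          push_cast; simpa [hηdef] using this
        · have := hx _ hu' _ hmem hu.2
          push_cast; exact this.trans_le hle
      rw [e₁] at this
      exact this.le
    · rcases htt.2.eq_or_lt with rfl | hlt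
      · rw [e₂]
      have := (hη.mono (Icc_subset_Icc hmem.1 ht₂.2)).snd_gt hlt fun u hu => by
        have hu' : u ∈ Icc 0 T := ⟨hmem.1.trans hu.1.le, hu.2.le.trans ht₂.2⟩
        refine h.snd_neg (hηbox u hu') (h.prod_neg (n := 2 * j + e + 2) (by omega) ?_ ?_
          ⟨j + e + 1, by ring⟩)
        · have := hx _ hmem _ hu' hu.1
          push_cast
          refine lt_of_le_of_lt (le_trans (le_of_eq (by ring)) hle) this
        · have := hx _ hu' _ ht₂ hu.2
          rw [h₂] at this
          push_cast
          refine lt_of_lt_of_eq this (by ring)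
      rw [e₂] at this
      exact this.le
  refine ⟨h.box.mem _ ?_, hy⟩
  have hg := hbox t hmem
  have h1 : ‖(γ t).1‖ ≤ ρ := (norm_fst_le _).trans hg
  have h2 : ‖(γ t).2‖ ≤ ρ := (norm_snd_le _).trans hg
  have h3 := h.bump_lt (γ t).1
  rw [Prod.norm_mk]
  refine max_le (by linarith [h.box.pos]) ((norm_sub_le _ _).trans ?_)
  rw [Real.norm_eq_abs (bumpSum e s A (γ t).1)]
  linarith

end GridConfig

/-! ### Counting orbit segments -/

/-- A block of `ℓ` consecutive indices below `N` is full exactly if its end does not exceed `N`. -/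
theorem encard_quotient_fibre {N ℓ g : ℕ} :
    {n | n < N ∧ n / ℓ = g}.encard = (ℓ : ℕ∞) ∧ 1 ≤ ℓ ↔ 1 ≤ ℓ ∧ (g + 1) * ℓ ≤ N := by
  rw [and_comm]
  refine and_congr_right fun hℓ => ?_
  have : {n | n < N ∧ n / ℓ = g} = (Finset.Ico (g * ℓ) (min N ((g + 1) * ℓ)) : Set ℕ) := by
    ext n
    simp only [Finset.coe_Ico, mem_Ico, lt_min_iff, mem_ofPred_eq]
    rw [Nat.div_eq_iff (by omega)]
    constructor
    · rintro ⟨h1, h2, h3⟩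
      have : (g + 1) * ℓ = g * ℓ + ℓ := by ring
      omega
    · rintro ⟨h1, h2, h3⟩
      have : (g + 1) * ℓ = g * ℓ + ℓ := by ring
      omega
  rw [this, encard_coe_eq_coe_finsetCard, Nat.card_Ico, Nat.cast_inj]
  have : (g + 1) * ℓ = g * ℓ + ℓ := by ring
  omega

/-- If the visible points are `pt 0, …, pt (N - 1)` and two of them lie on the same orbit segment
exactly if they belong to the same block of `ℓ` consecutive indices, then the orbit segments with
exactly `ℓ` visible points correspond to the `N / ℓ` full blocks. -/
theorem encard_orbitSegments {Z : ℝ × ℝ → ℝ × ℝ} {D : Set (ℝ × ℝ)} (hZ : ContDiff ℝ 1 Z) {r : ℝ}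
    {N ℓ : ℕ} (hℓ : 1 ≤ ℓ) {pt : ℕ → ℝ × ℝ} (hinj : Function.Injective pt)
    (hD : ∀ j < N, pt j ∈ D)
    (hvis : ∀ p : ℝ × ℝ, p.2 = 0 ∧ |p.1| < r ∧ IsVisible Z p.1 ↔ ∃ j < N, p = pt j)
    (hjoin : ∀ i < N, ∀ j < N, JoinedIn Z D (pt i) (pt j) ↔ i / ℓ = j / ℓ) :
    {Γ | IsOrbitSegment Z D Γ ∧ (visiblePointsOn Z r Γ).encard = (ℓ : ℕ∞)}.encard =
      ((N / ℓ : ℕ) : ℕ∞) := by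
  have hvisOn : ∀ i < N, (visiblePointsOn Z r {q | JoinedIn Z D (pt i) q}).encard =
      {n | n < N ∧ n / ℓ = i / ℓ}.encard := by
    intro i hi
    have : visiblePointsOn Z r {q | JoinedIn Z D (pt i) q} = pt '' {n | n < N ∧ n / ℓ = i / ℓ} := by
      ext p
      simp only [visiblePointsOn, mem_ofPred_eq, hvis, mem_image]
      constructor
      · rintro ⟨h1, j, hj, rfl⟩
        exact ⟨j, ⟨hj, ((hjoin i hi j hj).1 h1).symm⟩, rfl⟩
      · rintro ⟨j, ⟨hj, hij⟩, rfl⟩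
        exact ⟨(hjoin i hi j hj).2 hij.symm, j, hj, rfl⟩
    rw [this, hinj.encard_image]
  have hset : {Γ | IsOrbitSegment Z D Γ ∧ (visiblePointsOn Z r Γ).encard = (ℓ : ℕ∞)} =
      (fun g : ℕ => {q | JoinedIn Z D (pt (g * ℓ)) q}) '' (Finset.range (N / ℓ) : Set ℕ) := by
    ext Γ
    simp only [mem_ofPred_eq, mem_image, Finset.coe_range, mem_Iio]
    constructor
    · rintro ⟨⟨p, hp, rfl⟩, hcard⟩
      have hne : (visiblePointsOn Z r {q | JoinedIn Z D p q}).Nonempty := by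
        rw [nonempty_iff_ne_empty]
        rintro h0
        rw [h0, encard_empty] at hcard
        have : ℓ = 0 := by exact_mod_cast hcard.symm
        omega
      obtain ⟨q, hq, hq'⟩ := hne
      obtain ⟨i, hi, rfl⟩ := (hvis q).1 hq'
      have hsegs : ∀ j < N, j / ℓ = i / ℓ →
          {q | JoinedIn Z D (pt j) q} = {q | JoinedIn Z D p q} := by
        intro j hj hji
        have hpj : JoinedIn Z D p (pt j) := joinedIn_trans hZ hq ((hjoin i hi j hj).2 hji.symm)
        ext q
        exact ⟨fun h => joinedIn_trans hZ hpj h, fun h => joinedIn_trans hZ (joinedIn_symm hpj) h⟩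
      rw [← hsegs i hi rfl, hvisOn i hi] at hcard
      have hfull := (encard_quotient_fibre.1 ⟨hcard, hℓ⟩).2
      have hlt : i / ℓ < N / ℓ := (Nat.le_div_iff_mul_le (by omega)).2 hfull
      have hltN : i / ℓ * ℓ < N := by
        have := Nat.div_mul_le_self i ℓ
        omega
      exact ⟨i / ℓ, hlt, hsegs _ hltN (Nat.mul_div_cancel _ (by omega))⟩
    · rintro ⟨g, hg, rfl⟩
      have hfull := (Nat.le_div_iff_mul_le (by omega : 0 < ℓ)).1 (Nat.succ_le_of_lt hg)
      have hgN : g * ℓ < N := by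
        rw [Nat.succ_mul] at hfull
        omega
      refine ⟨⟨_, hD _ hgN, rfl⟩, ?_⟩
      rw [hvisOn _ hgN, Nat.mul_div_cancel _ (by omega)]
      exact (encard_quotient_fibre.2 ⟨hℓ, hfull⟩).1
  rw [hset, InjOn.encard_image, encard_coe_eq_coe_finsetCard, Finset.card_range]
  intro g hg g' hg' heq
  have hlt : ∀ g ∈ (Finset.range (N / ℓ) : Set ℕ), g * ℓ < N := by
    intro g hg
    have hfull := (Nat.le_div_iff_mul_le (by omega : 0 < ℓ)).1
      (Nat.succ_le_of_lt (Finset.mem_range.1 (Finset.mem_coe.1 hg)))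
    rw [Nat.succ_mul] at hfull
    omega
  have h1 : pt (g' * ℓ) ∈ {q | JoinedIn Z D (pt (g * ℓ)) q} := by
    simp only at heq
    rw [heq]
    exact joinedIn_refl (hD _ (hlt g' hg'))
  have := (hjoin _ (hlt g hg) _ (hlt g' hg')).1 h1
  rwa [Nat.mul_div_cancel _ (by omega), Nat.mul_div_cancel _ (by omega)] at this

/-! ### Choice of the parameters -/

/-- Infinitely many heights over `x₀` in a given interval lie on pairwise different orbits, since
each orbit passes over `x₀` at countably many heights only. -/
theorem exists_seq_not_joined {V : ℝ × ℝ → ℝ × ℝ} (hV : ContDiff ℝ 1 V) {x₀ a b : ℝ} (hab : a < b)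
    (hpos : ∀ y ∈ Ioo a b, (V (x₀, y)).1 ≠ 0) :
    ∃ h : ℕ → ℝ, (∀ g, h g ∈ Ioo a b) ∧
      ∀ g g', JoinedIn V univ (x₀, h g) (x₀, h g') → g = g' := by
  obtain ⟨h, h1, h2⟩ := exists_seq_of_forall_finset_exists (fun y => y ∈ Ioo a b)
    (fun y y' => ¬ JoinedIn V univ (x₀, y) (x₀, y')) (fun S hS => by
      have hc : (⋃ y ∈ S, {y' | JoinedIn V univ (x₀, y) (x₀, y') ∧
          (V (x₀, y')).1 ≠ 0}).Countable := by
        refine S.countable_toSet.biUnion fun y _ => ?_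
        refine MapsTo.countable_of_injOn (f := fun y' => (x₀, y')) ?_ ?_
          (countable_joinedIn hV (x₀, y) x₀)
        · exact fun y' hy' => ⟨hy'.1, rfl, hy'.2⟩
        · intro y' _ y'' _ heq
          exact (Prod.mk.inj heq).2
      obtain ⟨y, hy, hy'⟩ : (Ioo a b \ ⋃ y ∈ S, {y' | JoinedIn V univ (x₀, y) (x₀, y') ∧
          (V (x₀, y')).1 ≠ 0}).Nonempty := by
        rw [nonempty_iff_ne_empty]
        intro h0
        refine (Cardinal.Real.Ioo_countable_iff.1 (hc.mono (sdiff_eq_empty.1 h0))).not_gt hab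
      refine ⟨y, hy, fun x hx hJ => hy' ?_⟩
      simp only [mem_iUnion]
      exact ⟨x, hx, hJ, hpos y hy⟩)
  refine ⟨h, h1, fun g g' hJ => ?_⟩
  by_contra hne
  rcases lt_or_gt_of_ne hne with hlt | hlt
  · exact h2 _ _ hlt hJ
  · exact h2 _ _ hlt (joinedIn_symm hJ)

theorem eventually_mul_lt (C : ℝ) {η : ℝ} (hη : 0 < η) : ∀ᶠ s in 𝓝[>] (0 : ℝ), C * s < η := by
  have hc : ContinuousAt (fun s : ℝ => C * s) 0 := by fun_prop
  have := hc.eventually (gt_mem_nhds (show C * 0 < η by simpa using hη))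
  exact this.filter_mono nhdsWithin_le_nhds

/-- The parity `e` of the visible roots is the one for which `φ` times the product of the
`x - λ_i` is positive to the right of them, so there are `(m + 1 - e) / 2` visible roots. -/
theorem hasBifurcatingTangentOrbits_of_sign {f φ : ℝ × ℝ → ℝ} {U : Set (ℝ × ℝ)} (hU : IsOpen U)
    (hUb : Bornology.IsBounded U) (hU0 : ((0, 0) : ℝ × ℝ) ∈ U) (hf : ContDiff ℝ ∞ f)
    (hφ : ContDiff ℝ ∞ φ) (hf0 : 0 < f (0, 0)) {m e ℓ : ℕ} (r₁ r₂ : ℝ)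
    (he : e ≤ 1) (hem : e < m) (hsign : 0 < φ (0, 0) * (-1) ^ (m + e + 1)) (hℓ : 1 ≤ ℓ)
    (hℓN : ℓ ≤ (m + 1 - e) / 2) :
    HasBifurcatingTangentOrbits f φ m U r₁ r₂ ℓ ((m + 1 - e) / 2 / ℓ) := by
  have hφ0 : φ (0, 0) ≠ 0 := fun h0 => by simp [h0] at hsign
  obtain ⟨ρ, c, M, g, hB⟩ := exists_boxBounds hf hφ hU hU0 hf0 hφ0
  obtain ⟨K, hK, s₀, hs₀, horb⟩ := exists_group_orbit hB hf hφ he hem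
  obtain ⟨N, hN⟩ : ∃ N, N = (m + 1 - e) / 2 := ⟨_, rfl⟩
  rw [← hN] at hℓN horb ⊢
  have hN0 : 0 < N := by omega
  refine ⟨N, hN0, ρ, hB.pos, fun ε hε => ?_⟩
  obtain ⟨δ₁, hδ₁, hC₁⟩ := exists_c1Close_fst hf hUb m hε
  obtain ⟨δ₂, hδ₂, hC₂⟩ := exists_c1Close_snd (φ := φ) hf hφ hUb m hε
  set δ := min δ₁ δ₂ with hδ
  have hδ0 : 0 < δ := lt_min hδ₁ hδ₂
  -- One small step size `s` for all smallness requirements.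
  obtain ⟨s, hs, hss₀, hs1, hmε, hmρ, hmδ, hNε, hKs, hKε, hψρ, hψδ⟩ : ∃ s : ℝ, 0 < s ∧ 1 * s < s₀ ∧
      1 * s < 1 ∧ m * s < ε ∧ m * s < ρ ∧ m * s < δ ∧ (2 * N + 1) * s < ε ∧ (2 * K) * s < 1 ∧
      (3 * K) * s < ε ∧ (6 * N * K) * s < ρ ∧ (15360 * N * K) * s < δ := by
    have hpos : ∀ᶠ s in 𝓝[>] (0 : ℝ), 0 < s := self_mem_nhdsWithin
    exact (hpos.and ((eventually_mul_lt 1 hs₀).and ((eventually_mul_lt 1 one_pos).and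
      ((eventually_mul_lt m hε).and ((eventually_mul_lt m hB.pos).and
      ((eventually_mul_lt m hδ0).and ((eventually_mul_lt (2 * N + 1) hε).and
      ((eventually_mul_lt (2 * K) one_pos).and ((eventually_mul_lt (3 * K) hε).and
      ((eventually_mul_lt (6 * N * K) hB.pos).and
      (eventually_mul_lt (15360 * N * K) hδ0))))))))))).exists
  rw [one_mul] at hss₀ hs1
  have hs4 : s ^ 4 ≤ 1 := pow_le_one₀ hs.le hs1.le
  have hs5 : s ^ 5 ≤ s := by nlinarith
  have hs5' : 0 < s ^ 5 := by positivity
  have hρ1 := hB.le_one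
  have hKs5 : 2 * K * s ^ 5 ≤ s := by
    have : 2 * K * s ^ 5 = (2 * K * s) * s ^ 4 := by ring
    nlinarith [pow_pos hs 4, pow_le_pow_of_le_one hs.le hs1.le (by norm_num : 1 ≤ 4)]
  have hsρ : s < ρ := by
    have : (1 : ℝ) ≤ m := by exact_mod_cast (by omega : 1 ≤ m)
    nlinarith
  set V := straightField f φ (gridRoots m s) with hVdef
  have hV : ContDiff ℝ 1 V := contDiff_straightField hf hφ
  obtain ⟨h, hh, hhj⟩ := exists_seq_not_joined hV (x₀ := e * s) (a := K * s ^ 5) (b := 2 * K * s ^ 5)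
    (by nlinarith [mul_pos hK hs5']) (fun y hy => by
      have hy0 : 0 < y := (mul_pos hK hs5').trans hy.1
      refine (hB.c_pos.trans_le (hB.le_f (e * s, y) ?_)).ne'
      rw [Prod.norm_mk, Real.norm_of_nonneg (by positivity), Real.norm_of_nonneg hy0.le]
      have : (e : ℝ) ≤ 1 := by exact_mod_cast he
      exact max_le (by nlinarith) (by linarith [hy.2]))
  have horb' : ∀ i : ℕ, _ := fun i => horb s hs hss₀.le (h i) (by
    rw [abs_of_pos ((mul_pos hK hs5').trans (hh i).1)]
    exact (hh i).2.le.trans hKs5)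
  choose γ T hT hγ hγ0 hγρ hγN using horb'
  choose! t ht htx hty using hγN
  -- The amplitudes are the heights at which the orbits of the blocks pass over the visible roots.
  set A : Fin N → ℝ := fun j => (γ (j / ℓ) (t (j / ℓ) j)).2 with hA
  have hAb : ∀ j, 0 ≤ A j ∧ A j ≤ 3 * K * s ^ 5 := by
    intro j
    have h1 := abs_le.1 (hty (j / ℓ) j j.isLt)
    have h2 := hh (j / ℓ)
    constructor
    · linarith [h1.1, h2.1]
    · linarith [h1.2, h2.2]
  have hAabs : ∀ j, |A j| ≤ 3 * K * s ^ 5 := fun j => by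
    rw [abs_of_nonneg (hAb j).1]; exact (hAb j).2
  set ψ := bumpSum e s A with hψ
  have hψ0 : ∀ x, |ψ x| ≤ 6 * N * K * s := by
    intro x
    refine (abs_bumpSum_le hAabs x).trans ?_
    have : (N : ℝ) * (3 * K * s ^ 5 * (2 * 1)) = 6 * N * K * s ^ 5 := by ring
    rw [this]
    gcongr
  have eqB : (N : ℝ) * (3 * K * s ^ 5 * (2 * (2560 / s ^ 4))) = 15360 * N * K * s := by
    field_simp; ring
  have hψ1 : ∀ x, |deriv ψ x| < δ := fun x =>
    (abs_deriv_bumpSum_le hs hs1.le hAabs x).trans_lt (by rwa [eqB])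
  have hψ2 : ∀ x, |deriv (deriv ψ) x| < δ := fun x =>
    (abs_deriv_deriv_bumpSum_le hs hs1.le hAabs x).trans_lt (by rwa [eqB])
  have hψ0' : ∀ x, |ψ x| < δ := fun x => (hψ0 x).trans_lt (by
    have : 0 ≤ (N : ℝ) * K * s := by positivity
    linarith)
  have hroots : ∀ i : Fin m, |gridRoots m s i| ≤ m * s := by
    intro i
    have : ((i : ℕ) : ℝ) ≤ m := by exact_mod_cast i.isLt.le
    rw [gridRoots, abs_of_nonneg (by positivity), mul_comm]
    gcongr
  have hjet : ∀ x, ‖((ψ x, deriv ψ x, deriv (deriv ψ) x, gridRoots m s) : Jet m)‖ < δ := by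
    intro x
    simp only [Prod.norm_mk, max_lt_iff]
    refine ⟨hψ0' x, hψ1 x, hψ2 x, (pi_norm_lt_iff hδ0).2 fun i => ?_⟩
    exact (hroots i).trans_lt hmδ
  have hψs : ContDiff ℝ ∞ ψ := contDiff_bumpSum hs
  have hψd : Differentiable ℝ ψ := hψs.differentiable (by simp)
  have hψdd : Differentiable ℝ (deriv ψ) :=
    ((contDiff_succ_iff_deriv (n := 1)).1 (hψs.of_le (by norm_cast))).2.2.differentiable (by simp)
  have hG : GridConfig f φ U ρ c M g m e N s A := by
    refine ⟨hB, hf, hφ, he, hem, hsign, hN, hs, fun j => (hAb j).1, fun x => ?_, hmρ⟩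
    exact (hψ0 x).trans_lt hψρ
  -- Each visible tangent point lies on the orbit of its block.
  have hlift : ∀ j < N, (γ (j / ℓ) (t (j / ℓ) j)).2 = ψ (s * (2 * j + e)) := by
    intro j hj
    exact (hG.bumpSum_visible ⟨j, hj⟩).symm
  refine ⟨gridRoots m s, gridParams e s A, fun i => (hroots i).trans_lt hmε, ?_, ?_, ?_⟩
  · refine abs_gridParams_lt he hs hNε fun j => (hAabs j).trans_lt ?_
    calc 3 * K * s ^ 5 ≤ 3 * K * s := by gcongr
      _ < ε := hKε
  · intro _
    refine smallBumps_gridParams fun j => (hAabs j).trans ?_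
    calc 3 * K * s ^ 5 = 3 * K * s * s ^ 4 := by ring
      _ ≤ ε * s ^ 4 := by gcongr
  rw [psi_gridParams r₁ r₂ hN0 hs]
  refine ⟨hC₁ _ _ hψd hψdd fun x => (hjet x).trans_le (min_le_left _ _),
    hC₂ _ _ hψd hψdd fun x => (hjet x).trans_le (min_le_right _ _), fun x hx hxt => ?_, ?_⟩
  · obtain ⟨n, hn, rfl⟩ := hG.exists_root_of_isTangentPoint hx hxt
    exact (hroots ⟨n, hn⟩).trans_lt hmε
  refine encard_orbitSegments hG.contDiff_field hℓ (pt := fun j => (s * (2 * j + e), 0)) ?_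
    (fun j hj => hG.visible_mem_upperRegion hj) (fun p => ?_) ?_
  · intro i j hij
    have := (Prod.mk.inj hij).1
    have h2 := mul_left_cancel₀ hs.ne' this
    have h3 : (i : ℝ) = j := by linarith
    exact_mod_cast h3
  · constructor
    · rintro ⟨h1, h2, h3⟩
      obtain ⟨j, hj, hx⟩ := (hG.isVisible_iff h2).1 h3
      exact ⟨j, hj, Prod.ext hx h1⟩
    · rintro ⟨j, hj, rfl⟩
      exact ⟨rfl, hG.visible_mem hj, (hG.isVisible_iff (hG.visible_mem hj)).2 ⟨j, hj, rfl⟩⟩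
  -- Points of the same block are joined, one after the other, along the orbit of the block.
  have hblock : ∀ k i, i + k < N → i / ℓ = (i + k) / ℓ →
      JoinedIn (unfoldedField f φ (gridRoots m s) ψ) (upperRegion U)
        (s * (2 * (i : ℕ) + e), 0) (s * (2 * ((i + k : ℕ) : ℝ) + e), 0) := by
    intro k
    induction k with
    | zero => exact fun i hi _ => joinedIn_refl (hG.visible_mem_upperRegion hi)
    | succ k ih =>
      intro i hi hik
      have hle1 : i / ℓ ≤ (i + k) / ℓ := Nat.div_le_div_right (by omega)
      have hle2 : (i + k) / ℓ ≤ (i + (k + 1)) / ℓ := Nat.div_le_div_right (by omega)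
      have hq : (i + k) / ℓ = (i + (k + 1)) / ℓ := by omega
      refine joinedIn_trans hG.contDiff_field (ih i (by omega) (by omega)) ?_
      have hk1 : i + k < N := by omega
      have hk2 : i + k + 1 < N := by omega
      have hx1 := htx ((i + k) / ℓ) (i + k) hk1
      have hx2 := htx ((i + k) / ℓ) (i + k + 1) hk2
      have hy1 := hlift (i + k) hk1
      have hy2 := hlift (i + k + 1) hk2
      rw [show (i + k + 1) / ℓ = (i + k) / ℓ from hq.symm] at hy2
      have := hG.joinedIn_succ (hγ ((i + k) / ℓ)) (hγρ _) hk2 (ht _ _ hk1) (ht _ _ hk2) hx1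
        (by rw [hx2]; push_cast; ring) (by rw [hx1, hy1]) (by rw [hx2, hy2])
      convert this using 4
      push_cast
      ring
  intro i hi j hj
  constructor
  · intro hJ
    have h1 := hJ.straighten hψd
    have hreach : ∀ j < N, JoinedIn V univ (e * s, h (j / ℓ))
        (s * (2 * (j : ℕ) + e), 0 + ψ (s * (2 * j + e))) := by
      intro j hj
      have htj := ht (j / ℓ) j hj
      refine ⟨γ (j / ℓ), 0, t (j / ℓ) j, htj.1, (hγ _).mono (Icc_subset_Icc_right htj.2),
        fun _ _ => mem_univ _, Or.inl ⟨hγ0 _, ?_⟩⟩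
      rw [zero_add]
      exact Prod.ext (htx _ _ hj) (hlift j hj)
    exact hhj _ _ (joinedIn_trans hV (joinedIn_trans hV (hreach i hi) h1)
      (joinedIn_symm (hreach j hj)))
  · intro hij
    rcases le_total i j with hle | hle
    · obtain ⟨k, rfl⟩ := Nat.exists_eq_add_of_le hle
      exact hblock k i hj hij
    · obtain ⟨k, rfl⟩ := Nat.exists_eq_add_of_le hle
      exact joinedIn_symm (hblock k j hi hij.symm)

/-! ### The type of the origin -/

section Classification
variable {f φ : ℝ × ℝ → ℝ} {m : ℕ}

theorem contDiff_upperField (hf : ContDiff ℝ ∞ f) (hφ : ContDiff ℝ ∞ φ) :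
    ContDiff ℝ 1 (upperField f φ m) := by
  rw [upperField_eq_unfoldedField]
  exact contDiff_unfoldedField hf hφ contDiff_const

theorem eventually_mul_pos (hφ : ContDiff ℝ ∞ φ) {σ : ℝ} (h : 0 < φ (0, 0) * σ) :
    ∀ᶠ q in 𝓝 ((0, 0) : ℝ × ℝ), 0 < φ q * σ :=
  (hφ.continuous.mul continuous_const).continuousAt.eventually (lt_mem_nhds h)

theorem neg_one_pow_mul_pow_pos {x : ℝ} (hx : x < 0) (m : ℕ) : 0 < (-1) ^ m * x ^ m := by
  rw [← mul_pow]
  exact pow_pos (by linarith) m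

theorem neg_one_pow_mul_self (m : ℕ) : ((-1 : ℝ) ^ m) * (-1) ^ m = 1 := by
  rw [← mul_pow]; simp

theorem rightSegmentAbove_upperField_iff (hf : ContDiff ℝ ∞ f) (hφ : ContDiff ℝ ∞ φ)
    (hf0 : 0 < f (0, 0)) (hφ0 : φ (0, 0) ≠ 0) :
    RightSegmentAbove (upperField f φ m) 0 ↔ 0 < φ (0, 0) := by
  have hZ := contDiff_upperField (m := m) hf hφ
  constructor
  · intro h
    by_contra hneg
    have hneg' : 0 < φ (0, 0) * (-1) := by
      have := lt_of_le_of_ne (not_lt.1 hneg) hφ0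
      linarith
    refine not_rightSegmentAbove_of_neg hZ.continuous hf0 ?_ h
    filter_upwards [eventually_mul_pos hφ hneg'] with q hq hx
    exact mul_neg_of_neg_of_pos (by linarith) (pow_pos hx m)
  · intro h
    have h' : 0 < φ (0, 0) * 1 := by linarith
    refine rightSegmentAbove_of_pos hZ hf0 ?_
    filter_upwards [eventually_mul_pos hφ h'] with q hq hx
    exact mul_pos (by linarith) (pow_pos hx m)

theorem leftSegmentAbove_upperField_iff (hf : ContDiff ℝ ∞ f) (hφ : ContDiff ℝ ∞ φ)
    (hf0 : 0 < f (0, 0)) (hφ0 : φ (0, 0) ≠ 0) :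
    LeftSegmentAbove (upperField f φ m) 0 ↔ φ (0, 0) * (-1) ^ m < 0 := by
  have hZ := contDiff_upperField (m := m) hf hφ
  have hsplit : ∀ q : ℝ × ℝ, (upperField f φ m q).2 = φ q * (-1) ^ m * ((-1) ^ m * q.1 ^ m) := by
    intro q
    rw [upperField]
    linear_combination (-φ q * q.1 ^ m) * neg_one_pow_mul_self m
  constructor
  · intro h
    by_contra hpos
    have hpos' : 0 < φ (0, 0) * (-1) ^ m :=
      lt_of_le_of_ne (not_lt.1 hpos) (mul_ne_zero hφ0 (pow_ne_zero _ (by norm_num))).symm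
    refine not_leftSegmentAbove_of_pos hZ.continuous hf0 ?_ h
    filter_upwards [eventually_mul_pos hφ hpos'] with q hq hx
    rw [hsplit]
    exact mul_pos hq (neg_one_pow_mul_pow_pos hx m)
  · intro h
    have h' : 0 < φ (0, 0) * -(-1) ^ m := by linarith
    refine leftSegmentAbove_of_neg hZ hf0 ?_
    filter_upwards [eventually_mul_pos hφ h'] with q hq hx
    rw [hsplit]
    exact mul_neg_of_neg_of_pos (by linarith) (neg_one_pow_mul_pow_pos hx m)

end Classification

theorem hasBifurcatingTangentOrbits_of_pos {U : Set (ℝ × ℝ)} (hU : IsOpen U)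
    (hUb : Bornology.IsBounded U) (hU0 : ((0, 0) : ℝ × ℝ) ∈ U) {f φ : ℝ × ℝ → ℝ}
    (hf : ContDiff ℝ ∞ f) (hφ : ContDiff ℝ ∞ φ) (hf0 : 0 < f (0, 0)) (hφ0 : φ (0, 0) ≠ 0) {m : ℕ}
    (r₁ r₂ : ℝ) :
    (IsInvisible (upperField f φ m) 0 → 1 < m → ∀ ℓ : ℕ, 1 ≤ ℓ → ℓ ≤ (m - 1) / 2 →
      HasBifurcatingTangentOrbits f φ m U r₁ r₂ ℓ ((m - 1) / (2 * ℓ))) ∧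
    ((IsVisible (upperField f φ m) 0 ∨ IsLeft (upperField f φ m) 0 ∨
        IsRight (upperField f φ m) 0) → 1 ≤ m → ∀ ℓ : ℕ, 1 ≤ ℓ → ℓ ≤ (m + 1) / 2 →
      HasBifurcatingTangentOrbits f φ m U r₁ r₂ ℓ ((m + 1) / (2 * ℓ))) := by
  have hR := rightSegmentAbove_upperField_iff (m := m) hf hφ hf0 hφ0
  have hL := leftSegmentAbove_upperField_iff (m := m) hf hφ hf0 hφ0
  have core := fun e ℓ => hasBifurcatingTangentOrbits_of_sign (m := m) (e := e) (ℓ := ℓ)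
    hU hUb hU0 hf hφ hf0 r₁ r₂
  simp only [← Nat.div_div_eq_div_mul]
  constructor
  · rintro ⟨-, hl, hr⟩ hm ℓ hℓ hℓN
    rw [hR, not_lt] at hr
    rw [hL, not_lt] at hl
    have hneg : φ (0, 0) < 0 := lt_of_le_of_ne hr hφ0
    have hodd : Odd m := by
      by_contra hev
      rw [Nat.not_odd_iff_even] at hev
      rw [hev.neg_one_pow] at hl
      linarith
    have hpar : Odd (m + 1 + 1) := by grind
    have := core 1 ℓ le_rfl hm (by rw [hpar.neg_one_pow]; linarith) hℓ (by omega)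
    have hN : (m + 1 - 1) / 2 = (m - 1) / 2 := by
      obtain ⟨k, rfl⟩ := hodd
      omega
    rwa [hN] at this
  · intro hv hm ℓ hℓ hℓN
    rcases lt_or_gt_of_ne hφ0 with hneg | hpos
    · -- For `φ (0, 0) < 0` the right segment is below, so the left one is above and `m` is even.
      have hl : LeftSegmentAbove (upperField f φ m) 0 := by
        rcases hv with hv | hv | hv
        · exact hv.2.1
        · exact hv.2.1
        · exact absurd (hR.1 hv.2.2) hneg.le.not_gt
      rw [hL] at hl
      have hev : Even m := by
        by_contra hodd
        rw [Nat.not_even_iff_odd] at hodd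
        rw [hodd.neg_one_pow] at hl
        linarith
      have hpar : Odd (m + 0 + 1) := by grind
      exact core 0 ℓ zero_le_one (by omega) (by rw [hpar.neg_one_pow]; linarith) hℓ (by omega)
    · rcases Nat.even_or_odd m with hev | hodd
      · have hpar : Even (m + 1 + 1) := by grind
        have hm1 : 1 < m := by
          obtain ⟨k, rfl⟩ := hev
          omega
        have hN : (m + 1 - 1) / 2 = (m + 1) / 2 := by
          obtain ⟨k, rfl⟩ := hev
          omega
        have := core 1 ℓ le_rfl hm1 (by rw [hpar.neg_one_pow]; linarith) hℓ (by omega)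
        rwa [hN] at this
      · have hpar : Even (m + 0 + 1) := by grind
        exact core 0 ℓ zero_le_one (by omega) (by rw [hpar.neg_one_pow]; linarith) hℓ (by omega)

end TangentBifurcation

end

theorem theorem2 (U : Set (ℝ × ℝ)) (hU : IsOpen U) (hUb : Bornology.IsBounded U)
    (hU0 : ((0, 0) : ℝ × ℝ) ∈ U) (f φ : ℝ × ℝ → ℝ) (hf : ContDiff ℝ ∞ f) (hφ : ContDiff ℝ ∞ φ)
    (hf0 : f (0, 0) ≠ 0) (hφ0 : φ (0, 0) ≠ 0) (m : ℕ) (r₁ r₂ : ℝ) (hr : r₁ < r₂) :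
    (TangentBifurcation.IsInvisible (TangentBifurcation.upperField f φ m) 0 → 1 < m →
      ∀ ℓ : ℕ, 1 ≤ ℓ → ℓ ≤ (m - 1) / 2 →
        TangentBifurcation.HasBifurcatingTangentOrbits f φ m U r₁ r₂ ℓ ((m - 1) / (2 * ℓ))) ∧
    ((TangentBifurcation.IsVisible (TangentBifurcation.upperField f φ m) 0 ∨
        TangentBifurcation.IsLeft (TangentBifurcation.upperField f φ m) 0 ∨
        TangentBifurcation.IsRight (TangentBifurcation.upperField f φ m) 0) → 1 ≤ m →
      ∀ ℓ : ℕ, 1 ≤ ℓ → ℓ ≤ (m + 1) / 2 →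
        TangentBifurcation.HasBifurcatingTangentOrbits f φ m U r₁ r₂ ℓ ((m + 1) / (2 * ℓ))) := by
  rcases lt_or_gt_of_ne hf0 with hneg | hpos
  · -- Reversing time makes `f (0, 0)` positive and keeps all notions involved.
    have hneg' : 0 < (-f) (0, 0) := by simpa using hneg
    have hφ0' : (-φ) (0, 0) ≠ 0 := by simpa using hφ0
    obtain ⟨h1, h2⟩ := TangentBifurcation.hasBifurcatingTangentOrbits_of_pos (f := -f) (φ := -φ)
      hU hUb hU0 hf.neg hφ.neg hneg' hφ0' (m := m) r₁ r₂
    simp only [TangentBifurcation.upperField_neg, TangentBifurcation.isInvisible_neg,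
      TangentBifurcation.isVisible_neg, TangentBifurcation.isLeft_neg,
      TangentBifurcation.isRight_neg] at h1 h2
    exact ⟨fun hv hm ℓ hℓ hℓN => (h1 hv hm ℓ hℓ hℓN).of_neg,
      fun hv hm ℓ hℓ hℓN => (h2 hv hm ℓ hℓ hℓN).of_neg⟩
  · exact TangentBifurcation.hasBifurcatingTangentOrbits_of_pos hU hUb hU0 hf hφ hpos hφ0 r₁ r₂
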